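/- Let $n\ge 0$ and let $\lambda$ be a partition of $n$, drawn in French notation. Let $M^\lambda$ be the complex permutation module of $\mathfrak S_n$ with basis the tabloids $\{t\}$ of shape $\lambda$, and for a tableau $t$ of shape $\lambda$ with entries $1,\dots,n$ let $e_t=\sum_{\sigma\in \mathrm{col}(t)}\mathrm{sgn}(\sigma)\{\sigma t\}\in M^\lambda$, where $\mathrm{col}(t)$ is the group of permutations preserving each column of $t$. Let $S^\lambda=\mathrm{span}\{e_t\}$ be the Specht module. For $S,T\in\mathrm{SYT}(\lambda)$ write $S\vartriangleleft T$ if the smallest letter lying in different positions in $S$ and $T$ is further weakly northwest in $T$ than in $S$. Let $\mathrm{ides}(T)$ be the set of $i\in[n-1]$ such that $i$ is south of $i+1$ in $T$. Let $\mathcal H_n(0)$ be the $\mathbb C$-algebra generated by $\overline\pi_1,\dots,\overline\pi_{n-1}$ with relations $\overline\pi_i^2=-\overline\pi_i$, $\overline\pi_i\overline\pi_j=\overline\pi_j\overline\pi_i$ for $|i-j|\ge2$, and $\overline\pi_i\overline\pi_{i+1}\overline\pi_i=\overline\pi_{i+1}\overline\pi_i\overline\pi_{i+1}$. For $I\subseteq[n-1]$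 let $C_I$ be its one-dimensional module on which $\overline\pi_i$ acts by $-1$ if $i\in I$ and by $0$ otherwise. For a finite-dimensional $\mathcal H_n(0)$-module $M$ let $F^Q_{char}(M)$ be the sum of the fundamental quasisymmetric functions $F_I=\sum x_{i_1}\cdots x_{i_n}$ (over $i_1\le\cdots\le i_n$ with $i_j<i_{j+1}$ for $j\in I$) over the factors $C_I$ of a composition series of $M$. For a finite-dimensional $\mathfrak S_n$-module $M$ with character $\chi$ let $F_{char}(M)=\sum_{\mu\vdash n}\chi_\mu\, p_\mu/z_\mu$. Let $s_\lambda=\sum_{T\in\mathrm{SSYT}(\lambda)}x^T$. All these functions are taken in $N$ variables $x_1,\dots,x_N$, where $N\ge 0$ is arbitrary. **Theorem.** The relation $\vartriangleleft$ is a strict total order on $\mathrm{SYT}(\lambda)$, and the standard polytabloids $e_T$, $T\in\mathrm{SYT}(\lambda)$, form a basis of $S^\lambda$. Order this basis by $\vartriangleleft$, and let $\mathrm{tt}(v)$ be the trailing term of $v$, that is, the term $c_Te_T$ with $c_T\neq0$ in the expansion of $v$ whose $T$ is smallest for $\vartriangleleft$. For every $i\in[n-1]$ and $T\in\mathrm{SYT}(\lambda)$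 one of the following cases holds, and there is exactly one $\mathcal H_n(0)$-action on the vector space $S^\lambda$ such that $$\overline\pi_i e_T=\begin{cases}0 & \text{if } \mathrm{tt}(s_ie_T)=e_T,\\ -e_T & \text{if } s_ie_T=e_U \text{ for a } U\in\mathrm{SYT}(\lambda) \text{ with } U\vartriangleright T,\text{ or } s_ie_T=-e_T,\\ s_ie_T & \text{if } s_ie_T=e_U \text{ for a } U\in\mathrm{SYT}(\lambda) \text{ with } U\vartriangleleft T.\end{cases}$$ Writing $\widehat{S^\lambda}$ for the resulting $\mathcal H_n(0)$-module, for every number $N$ of variables $$F^Q_{char}(\widehat{S^\lambda})=\sum_{T\in\mathrm{SYT}(\lambda)}F_{\mathrm{ides}(T)}=s_\lambda=F_{char}(S^\lambda).$$ -/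

import Mathlib

open Equiv MvPolynomial

noncomputable section

namespace ZeroHecke

/-! ### Tableaux

A partition is a Mathlib `YoungDiagram`, whose cells are pairs (row, column).  In French notation
row `0` is the bottom row, so a larger row index means further north and a larger column index
means further east.  Letters are `0, …, n - 1` (the elements of `Fin n`). -/

/-- The letter `i` (the `i`-th simple transposition exchanges the letters `lo i` and `hi i`). -/
def lo {n : ℕ} (i : Fin (n - 1)) : Fin n := ⟨i.1, by omega⟩

/-- The letter `i + 1`. -/
def hi {n : ℕ} (i : Fin (n - 1)) : Fin n := ⟨i.1 + 1, by omega⟩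

/-- The simple transposition `s_i`. -/
def simpleSwap {n : ℕ} (i : Fin (n - 1)) : Perm (Fin n) := Equiv.swap (lo i) (hi i)

/-- Tableaux of shape `lam` and content `1ⁿ`: each letter sits in exactly one cell,
and each cell holds exactly one letter. -/
def Tableau (n : ℕ) (lam : YoungDiagram) : Type := Fin n ≃ {c : ℕ × ℕ // c ∈ lam.cells}

instance (n : ℕ) (lam : YoungDiagram) : Finite (Tableau n lam) :=
  inferInstanceAs (Finite (Fin n ≃ {c : ℕ × ℕ // c ∈ lam.cells}))

variable {n : ℕ} {lam : YoungDiagram}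

namespace Tableau

/-- The cell that contains the letter `k`. -/
def pos (t : Tableau n lam) (k : Fin n) : ℕ × ℕ := (Equiv.toFun t k).1

/-- The row of the letter `k`. -/
def row (t : Tableau n lam) (k : Fin n) : ℕ := (t.pos k).1

/-- The column of the letter `k`. -/
def col (t : Tableau n lam) (k : Fin n) : ℕ := (t.pos k).2

/-- `σ • t` is the tableau `t` with each letter `k` replaced by `σ k`. -/
instance : MulAction (Perm (Fin n)) (Tableau n lam) where
  smul σ t := (Equiv.trans σ.symm t : Fin n ≃ _)
  one_smul _ := rfl
  mul_smul _ _ _ := rfl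

theorem row_smul (σ : Perm (Fin n)) (t : Tableau n lam) (k : Fin n) :
    (σ • t).row k = t.row (σ⁻¹ k) := rfl

theorem col_smul (σ : Perm (Fin n)) (t : Tableau n lam) (k : Fin n) :
    (σ • t).col k = t.col (σ⁻¹ k) := rfl

/-- Rows increase from left to right and columns increase from bottom to top. -/
def IsStandard (t : Tableau n lam) : Prop :=
  (∀ a b, t.row a = t.row b → t.col a < t.col b → a < b) ∧
    (∀ a b, t.col a = t.col b → t.row a < t.row b → a < b)

end Tableau

/-- Standard Young tableaux of shape `lam`. -/
def SYT (n : ℕ) (lam : YoungDiagram) : Type := {t : Tableau n lam // t.IsStandard}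

instance (n : ℕ) (lam : YoungDiagram) : Finite (SYT n lam) :=
  inferInstanceAs (Finite {t : Tableau n lam // t.IsStandard})

instance (n : ℕ) (lam : YoungDiagram) : Fintype (SYT n lam) := Fintype.ofFinite _

/-- `S ◁ T`: the smallest letter that lies in different positions in `S` and `T` is further to the
weakly northwest in `T` than in `S`. -/
def SYT.Below (S T : SYT n lam) : Prop :=
  ∃ k : Fin n, (∀ j < k, S.1.pos j = T.1.pos j) ∧ S.1.pos k ≠ T.1.pos k ∧
    S.1.row k ≤ T.1.row k ∧ T.1.col k ≤ S.1.col k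

/-- The `i`-descent set: the `i` such that `i` is south of `i + 1`. -/
def SYT.ides (T : SYT n lam) : Set (Fin (n - 1)) := {i | T.1.row (lo i) < T.1.row (hi i)}

/-! ### Tabloids, polytabloids and Specht modules -/

/-- Row equivalence: each row of `t` contains the same letters as the same row of `s`. -/
instance rowSetoid (n : ℕ) (lam : YoungDiagram) : Setoid (Tableau n lam) where
  r t s := ∀ k, t.row k = s.row k
  iseqv := ⟨fun _ _ => rfl, fun h k => (h k).symm, fun h h' k => (h k).trans (h' k)⟩

/-- Tabloids of shape `lam`. -/
def Tabloid (n : ℕ) (lam : YoungDiagram) : Type := Quotient (rowSetoid n lam)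

instance (n : ℕ) (lam : YoungDiagram) : Finite (Tabloid n lam) :=
  inferInstanceAs (Finite (Quotient (rowSetoid n lam)))

/-- The tabloid `{t}` of a tableau `t`. -/
def Tableau.tabloid (t : Tableau n lam) : Tabloid n lam := Quotient.mk _ t

instance : MulAction (Perm (Fin n)) (Tabloid n lam) where
  smul σ := Quotient.map (σ • ·) (fun _ _ h k => h (σ⁻¹ k))
  one_smul x := by
    induction x using Quotient.inductionOn with
    | h t => exact congrArg (Quotient.mk _) (one_smul _ t)
  mul_smul σ τ x := by
    induction x using Quotient.inductionOn with
    | h t => exact congrArg (Quotient.mk _) (mul_smul σ τ t)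

theorem smul_tabloid (σ : Perm (Fin n)) (t : Tableau n lam) :
    σ • t.tabloid = (σ • t).tabloid := rfl

/-- The permutation module `M^lam` with basis the tabloids. -/
abbrev PermModule (n : ℕ) (lam : YoungDiagram) : Type := Tabloid n lam →₀ ℂ

/-- The action of the symmetric group on `M^lam`. -/
def permRep (n : ℕ) (lam : YoungDiagram) :
    Representation ℂ (Perm (Fin n)) (PermModule n lam) where
  toFun σ := Finsupp.lmapDomain ℂ ℂ (σ • ·)
  map_one' := by ext; simp
  map_mul' σ τ := by ext; simp [mul_smul]

/-- The group `col(t)` of permutations of the letters that preserve each column of `t`. -/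
def Tableau.colStab (t : Tableau n lam) : Subgroup (Perm (Fin n)) where
  carrier := {σ | ∀ k, t.col (σ k) = t.col k}
  one_mem' _ := rfl
  mul_mem' {σ τ} hσ hτ k := (hσ (τ k)).trans (hτ k)
  inv_mem' {σ} hσ k := by simpa using (hσ (σ⁻¹ k)).symm

open Classical in
/-- The polytabloid `e_t`, the signed sum of the tabloids `{σ t}` over `σ ∈ col(t)`. -/
def Tableau.polytabloid (t : Tableau n lam) : PermModule n lam :=
  ∑ σ ∈ Finset.univ.filter (· ∈ t.colStab),
    Finsupp.single (σ • t).tabloid ((Perm.sign σ : ℤ) : ℂ)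

theorem permRep_polytabloid (σ : Perm (Fin n)) (t : Tableau n lam) :
    permRep n lam σ t.polytabloid = (σ • t).polytabloid := by
  classical
  unfold Tableau.polytabloid
  rw [map_sum]
  refine Finset.sum_equiv (MulAut.conj σ).toEquiv ?_ ?_
  · intro τ
    simp only [Finset.mem_filter, Finset.mem_univ, true_and]
    constructor
    · intro h k
      simpa [Tableau.col_smul] using h (σ⁻¹ k)
    · intro h k
      simpa [Tableau.col_smul] using h (σ k)
  · intro τ _
    have h : Perm.sign (MulAut.conj σ τ) = Perm.sign τ := by
      rw [MulAut.conj_apply, map_mul, map_mul, mul_right_comm, ← map_mul]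
      simp
    change permRep n lam σ (Finsupp.single (τ • t).tabloid ((Perm.sign τ : ℤ) : ℂ)) =
      Finsupp.single (MulAut.conj σ τ • σ • t).tabloid ((Perm.sign (MulAut.conj σ τ) : ℤ) : ℂ)
    rw [h]
    simp [permRep, smul_tabloid, smul_smul]

/-- The Specht module as a subrepresentation of `M^lam`: the span of all polytabloids. -/
def spechtSub (n : ℕ) (lam : YoungDiagram) : Subrepresentation (permRep n lam) where
  toSubmodule := Submodule.span ℂ (Set.range (Tableau.polytabloid (n := n) (lam := lam)))
  apply_mem_toSubmodule σ v hv := by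
    induction hv using Submodule.span_induction with
    | mem x hx =>
      obtain ⟨t, rfl⟩ := hx
      rw [permRep_polytabloid]
      exact Submodule.subset_span ⟨_, rfl⟩
    | zero => simp
    | add x y _ _ hx hy => rw [map_add]; exact add_mem hx hy
    | smul a x _ hx => rw [map_smul]; exact Submodule.smul_mem _ _ hx

/-- The Specht module `S^lam`. -/
def Specht (n : ℕ) (lam : YoungDiagram) : Type := (spechtSub n lam).toSubmodule

instance (n : ℕ) (lam : YoungDiagram) : AddCommGroup (Specht n lam) :=
  inferInstanceAs (AddCommGroup (spechtSub n lam).toSubmodule)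

instance (n : ℕ) (lam : YoungDiagram) : Module ℂ (Specht n lam) :=
  inferInstanceAs (Module ℂ (spechtSub n lam).toSubmodule)

instance (n : ℕ) (lam : YoungDiagram) : Module.Finite ℂ (Specht n lam) :=
  inferInstanceAs (Module.Finite ℂ (spechtSub n lam).toSubmodule)

/-- The action of the symmetric group on the Specht module. -/
def spechtRep (n : ℕ) (lam : YoungDiagram) : Representation ℂ (Perm (Fin n)) (Specht n lam) :=
  (spechtSub n lam).toRepresentation

/-- The polytabloid `e_t` as an element of the Specht module. -/
def Tableau.polytabloidSpecht (t : Tableau n lam) : Specht n lam :=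
  (⟨t.polytabloid, Submodule.subset_span ⟨t, rfl⟩⟩ : (spechtSub n lam).toSubmodule)

/-! ### Symmetric and quasisymmetric functions in `N` variables -/

/-- The number `z_μ`, the product over `i` of `i ^ mᵢ * mᵢ!`, where `mᵢ` is the multiplicity of
the part `i` in `μ`. -/
def zee (μ : n.Partition) : ℕ :=
  ∏ i ∈ μ.parts.toFinset, i ^ μ.parts.count i * (μ.parts.count i).factorial

theorem exists_perm_partition (μ : n.Partition) :
    ∃ σ : Perm (Fin n), σ.partition.parts = μ.parts := by
  obtain ⟨σ, hσ⟩ := (Perm.exists_with_cycleType_iff (Fin n) (m := μ.parts.filter (2 ≤ ·))).2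
    ⟨by
      rw [Fintype.card_fin]
      obtain ⟨u, hu⟩ := Multiset.le_iff_exists_add.1 (Multiset.filter_le (2 ≤ ·) μ.parts)
      have h := congrArg Multiset.sum hu
      rw [Multiset.sum_add, μ.parts_sum] at h
      omega, fun a ha => (Multiset.mem_filter.1 ha).2⟩
  refine ⟨σ, ?_⟩
  have h1 : μ.parts.filter (fun a => ¬ 2 ≤ a)
      = Multiset.replicate (Multiset.card (μ.parts.filter (fun a => ¬ 2 ≤ a))) 1 := by
    refine Multiset.eq_replicate_card.2 fun b hb => ?_
    have := Multiset.mem_filter.1 hb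
    have h3 := μ.parts_pos this.1
    omega
  have h2 := Multiset.filter_add_not (fun a => 2 ≤ a) μ.parts
  have h3 : (μ.parts.filter (fun a => 2 ≤ a)).sum
      + Multiset.card (μ.parts.filter (fun a => ¬ 2 ≤ a)) = n := by
    have := congrArg Multiset.sum h2
    rw [Multiset.sum_add, h1, μ.parts_sum] at this
    simpa using this
  rw [Perm.parts_partition, ← Perm.sum_cycleType, hσ, Fintype.card_fin]
  conv_rhs => rw [← h2, h1]
  congr 2
  omega

/-- A permutation of cycle type `μ`. -/
def cycleRep (μ : n.Partition) : Perm (Fin n) := (exists_perm_partition μ).choose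

/-- The Frobenius characteristic of a representation of the symmetric group, the sum over the
partitions `μ` of `n` of `χ_μ p_μ / z_μ`. -/
def frobChar (N : ℕ) {V : Type*} [AddCommMonoid V] [Module ℂ V]
    (R : Representation ℂ (Perm (Fin n)) V) : MvPolynomial (Fin N) ℂ :=
  ∑ μ : n.Partition, C (LinearMap.trace ℂ V (R (cycleRep μ)) / (zee μ : ℂ)) * psumPart (Fin N) ℂ μ

/-- Semistandard Young tableaux of shape `lam` with entries in `{0, …, N - 1}`. -/
def SSYT (N : ℕ) (lam : YoungDiagram) : Type :=
  {T : SemistandardYoungTableau lam // ∀ i j, (i, j) ∈ lam → T i j < N}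

instance (N : ℕ) (lam : YoungDiagram) : Finite (SSYT N lam) := by
  refine Finite.of_injective
    (fun T : SSYT N lam => fun c : {c : ℕ × ℕ // c ∈ lam.cells} =>
      (⟨T.1 c.1.1 c.1.2, T.2 _ _ c.2⟩ : Fin N)) fun T T' h => Subtype.ext ?_
  ext i j
  by_cases hc : (i, j) ∈ lam
  · exact congrArg Fin.val (congrFun h ⟨(i, j), hc⟩)
  · rw [T.1.zeros hc, T'.1.zeros hc]

instance (N : ℕ) (lam : YoungDiagram) : Fintype (SSYT N lam) := Fintype.ofFinite _

/-- The Schur function `s_lam` in `N` variables. -/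
def schur (N : ℕ) (lam : YoungDiagram) : MvPolynomial (Fin N) ℂ :=
  ∑ T : SSYT N lam, ∏ c : {c : ℕ × ℕ // c ∈ lam.cells}, X ⟨T.1 c.1.1 c.1.2, T.2 _ _ c.2⟩

open Classical in
/-- The fundamental quasisymmetric function `F_K` of degree `n` in `N` variables: the sum of
`x_{f 0} ⋯ x_{f (n-1)}` over weakly increasing `f` that increase strictly at each `j ∈ K`. -/
def fundamental (N n : ℕ) (K : Set (Fin (n - 1))) : MvPolynomial (Fin N) ℂ :=
  ∑ f ∈ (Finset.univ : Finset (Fin n → Fin N)).filter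
      (fun f => Monotone f ∧ ∀ j ∈ K, f (lo j) < f (hi j)),
    ∏ k, X (f k)

/-! ### The 0-Hecke algebra -/

/-- The defining relations of the 0-Hecke algebra. -/
inductive HeckeRel (n : ℕ) :
    FreeAlgebra ℂ (Fin (n - 1)) → FreeAlgebra ℂ (Fin (n - 1)) → Prop
  | sq (i : Fin (n - 1)) :
      HeckeRel n (FreeAlgebra.ι ℂ i * FreeAlgebra.ι ℂ i) (-FreeAlgebra.ι ℂ i)
  | comm (i j : Fin (n - 1)) (h : i.1 + 2 ≤ j.1) :
      HeckeRel n (FreeAlgebra.ι ℂ i * FreeAlgebra.ι ℂ j) (FreeAlgebra.ι ℂ j * FreeAlgebra.ι ℂ i)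
  | braid (i j : Fin (n - 1)) (h : j.1 = i.1 + 1) :
      HeckeRel n (FreeAlgebra.ι ℂ i * FreeAlgebra.ι ℂ j * FreeAlgebra.ι ℂ i)
        (FreeAlgebra.ι ℂ j * FreeAlgebra.ι ℂ i * FreeAlgebra.ι ℂ j)

/-- The 0-Hecke algebra `H_n(0)` over `ℂ`. -/
def HeckeZero (n : ℕ) : Type := RingQuot (HeckeRel n)

instance (n : ℕ) : Ring (HeckeZero n) := inferInstanceAs (Ring (RingQuot (HeckeRel n)))

instance (n : ℕ) : Algebra ℂ (HeckeZero n) :=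
  inferInstanceAs (Algebra ℂ (RingQuot (HeckeRel n)))

/-- The generator `π̄_i`. -/
def HeckeZero.gen (i : Fin (n - 1)) : HeckeZero n :=
  RingQuot.mkAlgHom ℂ (HeckeRel n) (FreeAlgebra.ι ℂ i)

section Characteristic

variable {V : Type*} [AddCommGroup V] [Module (HeckeZero n) V]

/-- For submodules `A ≤ B`, the set of `i` such that `π̄_i` acts as `-1` on the quotient `B / A`.
If the quotient is simple, hence one-dimensional, this is the `I` with `B / A ≅ C_I`. -/
def factorIndex (A B : Submodule (HeckeZero n) V) : Set (Fin (n - 1)) :=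
  {i | ∀ q : B ⧸ A.submoduleOf B, HeckeZero.gen i • q = -q}

/-- The sum of `F_I` over the composition factors `C_I` of a composition series. -/
def seriesChar (N : ℕ) (s : CompositionSeries (Submodule (HeckeZero n) V)) :
    MvPolynomial (Fin N) ℂ :=
  ∑ j : Fin s.length, fundamental N n (factorIndex (s j.castSucc) (s j.succ))

theorem factorIndex_congr {A B A' B' : Submodule (HeckeZero n) V}
    (e : (B ⧸ A.submoduleOf B) ≃ₗ[HeckeZero n] (B' ⧸ A'.submoduleOf B')) :
    factorIndex A B = factorIndex A' B' := by
  ext i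
  constructor
  · intro h q
    have := congrArg e (h (e.symm q))
    simpa using this
  · intro h q
    have := congrArg e.symm (h (e q))
    simpa using this

theorem seriesChar_eq (N : ℕ) (s t : CompositionSeries (Submodule (HeckeZero n) V))
    (hh : s.head = t.head) (hl : s.last = t.last) : seriesChar N s = seriesChar N t := by
  obtain ⟨f, hf⟩ := s.jordan_holder t hh hl
  refine Fintype.sum_equiv f _ _ fun j => ?_
  exact congrArg _ (factorIndex_congr (JordanHolderLattice.Iso.linearEquiv (hf j)))

theorem exists_series (V : Type*) [AddCommGroup V] [Module (HeckeZero n) V] [Module ℂ V]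
    [IsScalarTower ℂ (HeckeZero n) V] [Module.Finite ℂ V] :
    ∃ s : CompositionSeries (Submodule (HeckeZero n) V), s.head = ⊥ ∧ s.last = ⊤ := by
  have : IsNoetherian (HeckeZero n) V := isNoetherian_of_tower ℂ inferInstance
  have : IsArtinian (HeckeZero n) V := isArtinian_of_tower ℂ inferInstance
  exact exists_compositionSeries_of_isNoetherian_isArtinian _ _

/-- The quasisymmetric Frobenius characteristic of a finite-dimensional `H_n(0)`-module, computed
from a composition series.  By `seriesChar_eq` it does not depend on the series. -/
def frobQChar (N n : ℕ) (V : Type*) [AddCommGroup V] [Module (HeckeZero n) V] [Module ℂ V]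
    [IsScalarTower ℂ (HeckeZero n) V] [Module.Finite ℂ V] : MvPolynomial (Fin N) ℂ :=
  seriesChar N (exists_series (n := n) V).choose

end Characteristic

section Deformation

variable {V : Type*} [AddCommGroup V] [Module ℂ V]

/-- The vector space `V` as an `H_n(0)`-module, with `H_n(0)` acting through `ρ`. -/
def HeckeModule (_ρ : HeckeZero n →ₐ[ℂ] Module.End ℂ V) : Type _ := V

variable (ρ : HeckeZero n →ₐ[ℂ] Module.End ℂ V)

instance : AddCommGroup (HeckeModule ρ) := inferInstanceAs (AddCommGroup V)

instance : Module ℂ (HeckeModule ρ) := inferInstanceAs (Module ℂ V)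

instance [h : Module.Finite ℂ V] : Module.Finite ℂ (HeckeModule ρ) := h

instance : Module (HeckeZero n) (HeckeModule ρ) := Module.compHom V ρ.toRingHom

instance : IsScalarTower ℂ (HeckeZero n) (HeckeModule ρ) where
  smul_assoc c a v := by
    change ρ (c • a) v = c • ρ a v
    rw [map_smul]
    rfl

variable {ι : Type*}

/-- `w` is the trailing term of `v` with respect to the basis `B` and the strict total order `lt`:
the term `c_j B_j`, `c_j ≠ 0`, of the expansion of `v` whose basis vector is smallest. -/
def IsTrailingTerm (B : Module.Basis ι ℂ V) (lt : ι → ι → Prop) (v w : V) : Prop :=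
  ∃ j, B.repr v j ≠ 0 ∧ (∀ k, B.repr v k ≠ 0 → k = j ∨ lt j k) ∧ w = B.repr v j • B j

/-- The `H_n(0)`-action `ρ` is the deformation of the `S_n`-action `R` along the basis `B` with the
strict total order `lt`: every pair of a generator and a basis vector falls under one of the
cases below, and they determine how the generator acts. -/
structure IsDeformation (R : Representation ℂ (Perm (Fin n)) V) (B : Module.Basis ι ℂ V)
    (lt : ι → ι → Prop) (ρ : HeckeZero n →ₐ[ℂ] Module.End ℂ V) : Prop where
  exhaustive : ∀ i t, IsTrailingTerm B lt (R (simpleSwap i) (B t)) (B t) ∨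
    R (simpleSwap i) (B t) = -B t ∨
    ∃ u, R (simpleSwap i) (B t) = B u ∧ (lt t u ∨ lt u t)
  of_trailing : ∀ i t, IsTrailingTerm B lt (R (simpleSwap i) (B t)) (B t) →
    ρ (HeckeZero.gen i) (B t) = 0
  of_neg : ∀ i t, R (simpleSwap i) (B t) = -B t → ρ (HeckeZero.gen i) (B t) = -B t
  of_gt : ∀ i t u, R (simpleSwap i) (B t) = B u → lt t u → ρ (HeckeZero.gen i) (B t) = -B t
  of_lt : ∀ i t u, R (simpleSwap i) (B t) = B u → lt u t → ρ (HeckeZero.gen i) (B t) = B u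

end Deformation

end ZeroHecke

end

/-!
The three assertions about `S^lam` rest on triangularity; no straightening by Garnir relations is
needed.

*Order and basis.*  A standard tableau is determined by its row word `k ↦ row k`, and `◁` is the
lexicographic order on row words (`SYT.below_iff_lt`): the cells at the first difference are never
comparable in the southwest-northeast direction.  A column permutation makes the row word of a
standard tableau larger (`IsStandard.row_lt_smul`), so the standard polytabloids are independent.
For spanning, the coefficients of a vector of `M^lam` are read as a function on words, that is, as
an element of a tensor power.  Polytabloids are killed by the raising operators `E_{ab}`, `a < b`
(`raise_wordCoeff_polytabloid`).  A vector killed by `E_{ab}` has no words with more letters `b`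
than `a`, as `E_{ba}` would map it to a vector of negative square norm otherwise
(`eq_zero_of_raise_eq_zero`).  By induction on the last letter, a nonzero highest weight vector
involves a lattice word (`exists_isLattice`), and lattice words are the row words of standard
tableaux.  Hence an element of `S^lam` that vanishes at all standard tabloids is zero, which bounds
the dimension by the number of standard tableaux.

*Deformation.*  If `i` and `i + 1` lie in one row of `T`, then `s_i e_T` still has `{T}` as its
smallest tabloid, so that its trailing term is `e_T` (`isTrailingTerm_of_row_eq`); in the other
cases `s_i e_T` is `-e_T` or `e_{s_i T}`.  Sending `e_T` to the row word of `T` turns the prescribed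
operators into the operators on words that negate ascents, kill plateaus and sort descents, and
these satisfy the 0-Hecke relations (`wordOp_braid`).

*Characteristics.*  The operators are triangular for `◁`, with diagonal entry `-1` exactly at the
elements of `ides T`; the spans of the initial segments form a composition series
(`frobQChar_spechtHecke`).  Standardization gives `∑ F_{ides T} = s_lam`.  For the Frobenius
characteristic, the coefficient of `x^g`, `g` weakly increasing, is the dimension of the invariants
of the Young subgroup `stab g` (`frobChar_eq_sum_monotone`).  For `S^lam` this is the number of
`T` with `g` strictly increasing at all `i` in `ides T` (`finrank_fixedBy_stab`), the `T` for which
`x^g` occurs in `F_{ides T}`.  The averages of these `e_T` span, since a descent of `T` on a plateau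
of `g` kills the average of `e_T` or lets `T` be replaced by the larger `s_i T`.  They are
independent, since the statistic `∑ g(k) row(k)` singles out the term `{T}` by the rearrangement
inequality.
-/

noncomputable section

namespace ZeroHecke

variable {n : ℕ} {lam : YoungDiagram}

/-! ### Standard tableaux and their row words -/

namespace Tableau

theorem pos_injective (t : Tableau n lam) : Function.Injective t.pos :=
  Subtype.val_injective.comp (Equiv.injective (α := Fin n) t)

theorem pos_mem (t : Tableau n lam) (k : Fin n) : t.pos k ∈ lam := (Equiv.toFun t k).2

theorem exists_pos (t : Tableau n lam) {c : ℕ × ℕ} (hc : c ∈ lam) : ∃ k, t.pos k = c := by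
  obtain ⟨k, hk⟩ := Equiv.surjective (α := Fin n) t ⟨c, hc⟩
  exact ⟨k, congrArg Subtype.val hk⟩

theorem eq_of_row_col (t : Tableau n lam) {a b : Fin n} (hr : t.row a = t.row b)
    (hc : t.col a = t.col b) : a = b :=
  t.pos_injective (Prod.ext hr hc)

theorem ext_pos {s t : Tableau n lam} (h : ∀ k, s.pos k = t.pos k) : s = t :=
  Equiv.ext (α := Fin n) fun k => Subtype.ext (h k)

theorem tabloid_eq_iff {s t : Tableau n lam} : s.tabloid = t.tabloid ↔ ∀ k, s.row k = t.row k :=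
  Quotient.eq

theorem pos_smul (σ : Perm (Fin n)) (t : Tableau n lam) (k : Fin n) :
    (σ • t).pos k = t.pos (σ⁻¹ k) := rfl

/-- In a standard tableau, a cell weakly southwest of another one holds the smaller letter: pass
through the cell in the row of the first and the column of the second. -/
theorem IsStandard.le {t : Tableau n lam} (ht : t.IsStandard) {a b : Fin n}
    (hr : t.row a ≤ t.row b) (hc : t.col a ≤ t.col b) : a ≤ b := by
  obtain ⟨k, hk⟩ := t.exists_pos (c := (t.row a, t.col b))
    (lam.up_left_mem hr le_rfl (t.pos_mem b))
  have hkr : t.row k = t.row a := (congrArg Prod.fst hk :)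
  have hkc : t.col k = t.col b := (congrArg Prod.snd hk :)
  have h1 : a ≤ k := by
    rcases hc.lt_or_eq with h | h
    · exact (ht.1 a k hkr.symm (by omega)).le
    · exact (t.eq_of_row_col hkr.symm (by omega)).le
  have h2 : k ≤ b := by
    rcases hr.lt_or_eq with h | h
    · exact (ht.2 k b hkc (by omega)).le
    · exact (t.eq_of_row_col (by omega) hkc).le
  exact h1.trans h2

/-- In a standard tableau the column of `k` is the number of smaller letters in its row. -/
theorem IsStandard.col_eq_card {t : Tableau n lam} (ht : t.IsStandard) (k : Fin n) :
    t.col k = (Finset.univ.filter fun j => j < k ∧ t.row j = t.row k).card := by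
  rw [← Finset.card_range (t.col k)]
  symm
  refine Finset.card_bij (fun j _ => t.col j) ?_ ?_ ?_
  · intro j hj
    simp only [Finset.mem_filter, Finset.mem_univ, true_and] at hj
    rw [Finset.mem_range]
    by_contra hcon
    exact absurd (ht.le hj.2.ge (not_lt.1 hcon)) (not_le.2 hj.1)
  · intro a ha b hb hab
    simp only [Finset.mem_filter, Finset.mem_univ, true_and] at ha hb
    exact t.eq_of_row_col (ha.2.trans hb.2.symm) hab
  · intro c hc
    rw [Finset.mem_range] at hc
    obtain ⟨j, hj⟩ := t.exists_pos (c := (t.row k, c)) (lam.up_left_mem le_rfl hc.le (t.pos_mem k))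
    have hjr : t.row j = t.row k := (congrArg Prod.fst hj :)
    have hjc : t.col j = c := (congrArg Prod.snd hj :)
    exact ⟨j, by simpa using ⟨ht.1 j k hjr (by omega), hjr⟩, hjc⟩

/-- The first letters of a standard tableau are placed by their rows alone. -/
theorem IsStandard.pos_congr {s t : Tableau n lam} (hs : s.IsStandard) (ht : t.IsStandard)
    {k : Fin n} (h : ∀ j ≤ k, s.row j = t.row j) : s.pos k = t.pos k := by
  refine Prod.ext (h k le_rfl) ?_
  change s.col k = t.col k
  rw [hs.col_eq_card, ht.col_eq_card]
  congr 1
  ext j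
  simp only [Finset.mem_filter, Finset.mem_univ, true_and]
  constructor <;> rintro ⟨h1, h2⟩ <;> refine ⟨h1, ?_⟩
  · rw [← h j h1.le, ← h k le_rfl, h2]
  · rw [h j h1.le, h k le_rfl, h2]

/-- Letters in different rows and columns can be exchanged if they are consecutive. -/
theorem IsStandard.simpleSwap_smul {t : Tableau n lam} (ht : t.IsStandard) {i : Fin (n - 1)}
    (hr : t.row (lo i) ≠ t.row (hi i)) (hc : t.col (lo i) ≠ t.col (hi i)) :
    (simpleSwap i • t).IsStandard := by
  have key : ∀ a b : Fin n, simpleSwap i a < simpleSwap i b →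
      ¬ (simpleSwap i a = lo i ∧ simpleSwap i b = hi i) → a < b := by
    intro a b
    simp only [simpleSwap, Equiv.swap_apply_def, Fin.lt_def, Fin.ext_iff, lo, hi]
    split_ifs <;> simp_all <;> omega
  have hinv : (simpleSwap i)⁻¹ = simpleSwap i := Equiv.swap_inv _ _
  constructor
  · intro a b h1 h2
    rw [row_smul, row_smul, hinv] at h1
    rw [col_smul, col_smul, hinv] at h2
    exact key a b (ht.1 _ _ h1 h2) fun h => hr (by rwa [h.1, h.2] at h1)
  · intro a b h1 h2
    rw [col_smul, col_smul, hinv] at h1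
    rw [row_smul, row_smul, hinv] at h2
    exact key a b (ht.2 _ _ h1 h2) fun h => hc (by rwa [h.1, h.2] at h1)

end Tableau

theorem lo_lt_hi (i : Fin (n - 1)) : lo i < hi i := Fin.lt_def.2 (Nat.lt_succ_self _)

theorem Tableau.IsStandard.col_lt_of_row_le {t : Tableau n lam} (ht : t.IsStandard)
    {i : Fin (n - 1)} (h : t.row (hi i) ≤ t.row (lo i)) : t.col (lo i) < t.col (hi i) := by
  by_contra hcon
  exact absurd (ht.le h (not_lt.1 hcon)) (not_le.2 (lo_lt_hi i))

/-- The row word of a standard tableau, in the lexicographic order. -/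
def SYT.word (T : SYT n lam) : Lex (Fin n → ℕ) := toLex T.1.row

theorem SYT.word_injective : Function.Injective (SYT.word (n := n) (lam := lam)) := by
  intro S T h
  exact Subtype.ext (Tableau.ext_pos fun k =>
    S.2.pos_congr T.2 fun j _ => congrFun (toLex.injective h) j)

instance : LinearOrder (SYT n lam) := LinearOrder.lift' SYT.word SYT.word_injective

theorem SYT.lt_iff {S T : SYT n lam} :
    S < T ↔ ∃ k, (∀ j < k, S.1.row j = T.1.row j) ∧ S.1.row k < T.1.row k := Iff.rfl

/-- The relation `◁` is the lexicographic order on row words.  At the first letter placed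
differently neither cell is weakly southwest of the other one, so that the row decides. -/
theorem SYT.below_iff_lt {S T : SYT n lam} : S.Below T ↔ S < T := by
  rw [SYT.lt_iff]
  have aux : ∀ {S T : SYT n lam} {k : Fin n}, (∀ j < k, S.1.pos j = T.1.pos j) →
      S.1.pos k ≠ T.1.pos k → S.1.row k ≤ T.1.row k → S.1.col k ≤ T.1.col k → False := by
    intro S T k h hne hr hc
    obtain ⟨l, hl⟩ := T.1.exists_pos (S.1.pos_mem k)
    have hlk : l ≤ k := T.2.le ((congrArg Prod.fst hl).trans_le hr)
      ((congrArg Prod.snd hl).trans_le hc)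
    rcases hlk.lt_or_eq with h1 | h1
    · rw [← h l h1] at hl
      exact h1.ne (S.1.pos_injective hl)
    · exact hne (by rw [← hl, h1])
  constructor
  · rintro ⟨k, h1, h2, h3, h4⟩
    refine ⟨k, fun j hj => congrArg Prod.fst (h1 j hj), lt_of_le_of_ne h3 fun h => ?_⟩
    exact aux (fun j hj => (h1 j hj).symm) h2.symm h.ge h4
  · rintro ⟨k, h1, h2⟩
    have h3 : ∀ j < k, S.1.pos j = T.1.pos j := fun j hj =>
      S.2.pos_congr T.2 fun j' hj' => h1 j' (hj'.trans_lt hj)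
    have h4 : S.1.pos k ≠ T.1.pos k := fun h => h2.ne (congrArg Prod.fst h)
    refine ⟨k, h3, h4, h2.le, ?_⟩
    by_contra hcon
    exact aux h3 h4 h2.le (not_le.1 hcon).le

theorem SYT.below_eq : SYT.Below (n := n) (lam := lam) = (· < ·) :=
  funext₂ fun _ _ => propext SYT.below_iff_lt

/-- The standard tableau `s_i T`. -/
def SYT.swap (T : SYT n lam) (i : Fin (n - 1)) (hr : T.1.row (lo i) ≠ T.1.row (hi i))
    (hc : T.1.col (lo i) ≠ T.1.col (hi i)) : SYT n lam :=
  ⟨simpleSwap i • T.1, T.2.simpleSwap_smul hr hc⟩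

theorem SYT.row_swap (T : SYT n lam) (i : Fin (n - 1)) (hr) (hc) (k : Fin n) :
    (T.swap i hr hc).1.row k = T.1.row (simpleSwap i k) := by
  change T.1.row ((simpleSwap i)⁻¹ k) = _
  rw [show (simpleSwap i)⁻¹ = simpleSwap i from Equiv.swap_inv _ _]

@[simp] theorem simpleSwap_lo (i : Fin (n - 1)) : simpleSwap i (lo i) = hi i :=
  Equiv.swap_apply_left _ _

@[simp] theorem simpleSwap_hi (i : Fin (n - 1)) : simpleSwap i (hi i) = lo i :=
  Equiv.swap_apply_right _ _

theorem simpleSwap_of_lt {i : Fin (n - 1)} {j : Fin n} (h : j < lo i) : simpleSwap i j = j :=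
  Equiv.swap_apply_of_ne_of_ne h.ne (h.trans (lo_lt_hi i)).ne

theorem simpleSwap_of_gt {i : Fin (n - 1)} {j : Fin n} (h : hi i < j) : simpleSwap i j = j :=
  Equiv.swap_apply_of_ne_of_ne ((lo_lt_hi i).trans h).ne' h.ne'

theorem SYT.lt_swap {T : SYT n lam} {i : Fin (n - 1)} {hr} {hc} :
    T < T.swap i hr hc ↔ i ∈ T.ides := by
  have h0 : ∀ j < lo i, (T.swap i hr hc).1.row j = T.1.row j := fun j hj => by
    rw [SYT.row_swap, simpleSwap_of_lt hj]
  have h1 : (T.swap i hr hc).1.row (lo i) = T.1.row (hi i) := by rw [SYT.row_swap, simpleSwap_lo]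
  constructor
  · intro h
    by_contra hcon
    have h2 : T.1.row (hi i) < T.1.row (lo i) := lt_of_le_of_ne (not_lt.1 hcon) hr.symm
    exact lt_asymm h (SYT.lt_iff.2 ⟨lo i, h0, by rw [h1]; exact h2⟩)
  · intro h
    exact SYT.lt_iff.2 ⟨lo i, fun j hj => (h0 j hj).symm, by rw [h1]; exact h⟩

theorem SYT.swap_lt {T : SYT n lam} {i : Fin (n - 1)} {hr} {hc} :
    T.swap i hr hc < T ↔ i ∉ T.ides := by
  rw [← SYT.lt_swap (hr := hr) (hc := hc), not_lt]
  refine ⟨le_of_lt, fun h => lt_of_le_of_ne h fun h' => hr ?_⟩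
  have := SYT.row_swap T i hr hc (lo i)
  rwa [simpleSwap_lo, h'] at this

/-! ### Triangularity of the standard polytabloids -/

/-- The row word of a tabloid. -/
def Tabloid.word (x : Tabloid n lam) : Lex (Fin n → ℕ) :=
  Quotient.lift (fun t : Tableau n lam => toLex t.row) (fun _ _ h => congrArg toLex (funext h)) x

theorem Tabloid.word_injective : Function.Injective (Tabloid.word (n := n) (lam := lam)) := by
  intro x y h
  induction x using Quotient.inductionOn
  induction y using Quotient.inductionOn
  exact Tableau.tabloid_eq_iff.2 fun k => congrFun (toLex.injective h) k

open Classical in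
theorem permRep_polytabloid_apply (τ : Perm (Fin n)) (t : Tableau n lam) (x : Tabloid n lam) :
    permRep n lam τ t.polytabloid x = ∑ σ ∈ Finset.univ.filter (· ∈ t.colStab),
      if (τ • σ • t).tabloid = x then ((Perm.sign σ : ℤ) : ℂ) else 0 := by
  unfold Tableau.polytabloid
  rw [map_sum, Finsupp.finsetSum_apply]
  refine Finset.sum_congr rfl fun σ _ => ?_
  have : permRep n lam τ (Finsupp.single (σ • t).tabloid ((Perm.sign σ : ℤ) : ℂ)) =
      Finsupp.single (τ • σ • t).tabloid ((Perm.sign σ : ℤ) : ℂ) := by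
    simp [permRep, smul_tabloid]
  rw [this, Finsupp.single_apply]

open Classical in
theorem polytabloid_apply (t : Tableau n lam) (x : Tabloid n lam) :
    t.polytabloid x = ∑ σ ∈ Finset.univ.filter (· ∈ t.colStab),
      if (σ • t).tabloid = x then ((Perm.sign σ : ℤ) : ℂ) else 0 := by
  simpa using permRep_polytabloid_apply 1 t x

namespace Tableau

theorem pos_smul_of_mem {t : Tableau n lam} {σ : Perm (Fin n)} (hσ : σ ∈ t.colStab) (k : Fin n) :
    (σ • t).pos k = ((σ • t).row k, t.col k) :=
  Prod.ext rfl (by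
    have h := hσ (σ⁻¹ k)
    rw [← Perm.mul_apply, mul_inv_cancel] at h
    exact h.symm)

theorem eq_one_of_row_eq {t : Tableau n lam} {σ : Perm (Fin n)} (hσ : σ ∈ t.colStab)
    (h : ∀ k, (σ • t).row k = t.row k) : σ = 1 := by
  have : σ⁻¹ = 1 := Equiv.ext fun k => t.pos_injective (by
    rw [← pos_smul, pos_smul_of_mem hσ, h]; rfl)
  simpa using this

/-- Let `σ` permute the letters within the columns of a standard tableau and fix the places of the
letters below `m`.  A letter `k` does not move down if the smaller letters in lower rows are all
below `m`, since the cells under it are then occupied. -/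
theorem IsStandard.le_row_smul {t : Tableau n lam} (ht : t.IsStandard) {σ : Perm (Fin n)}
    (hσ : σ ∈ t.colStab) {m k : Fin n} (h : ∀ j < m, (σ • t).row j = t.row j)
    (hk : ∀ j < k, t.row j < t.row k → j < m) : t.row k ≤ (σ • t).row k := by
  by_contra hcon
  rw [not_le] at hcon
  -- `l` is the letter of `t` in the cell to which `k` moves
  set l := σ⁻¹ k with hl
  have hlr : t.row l = (σ • t).row k := rfl
  have hlc : t.col l = t.col k := (congrArg Prod.snd (pos_smul_of_mem hσ k) :)
  have hlk : l < k := ht.2 l k hlc (hlr ▸ hcon)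
  have hfix : (σ • t).pos l = (σ • t).pos k := by
    rw [pos_smul_of_mem hσ, pos_smul_of_mem hσ, h l (hk l hlk (hlr ▸ hcon)), hlr, hlc]
  exact hlk.ne ((σ • t).pos_injective hfix)

/-- A column permutation makes the row word of a standard tableau larger. -/
theorem IsStandard.row_lt_smul {t : Tableau n lam} (ht : t.IsStandard) {σ : Perm (Fin n)}
    (hσ : σ ∈ t.colStab) (h1 : σ ≠ 1) : toLex t.row < toLex (σ • t).row := by
  rcases lt_trichotomy (toLex t.row) (toLex (σ • t).row) with h | h | h
  · exact h
  · exact absurd (eq_one_of_row_eq hσ fun k => (congrFun (toLex.injective h) k).symm) h1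
  · obtain ⟨k, hk, hlt⟩ := h
    exact absurd (ht.le_row_smul hσ hk fun j hj _ => hj) (not_le.2 hlt)

theorem IsStandard.row_le_smul {t : Tableau n lam} (ht : t.IsStandard) {σ : Perm (Fin n)}
    (hσ : σ ∈ t.colStab) : toLex t.row ≤ toLex (σ • t).row := by
  rcases eq_or_ne σ 1 with rfl | h
  · rw [one_smul]
  · exact (ht.row_lt_smul hσ h).le

theorem row_simpleSwap_smul (t : Tableau n lam) (i : Fin (n - 1)) (k : Fin n) :
    (simpleSwap i • t).row k = t.row (simpleSwap i k) := by
  rw [row_smul, show (simpleSwap i)⁻¹ = simpleSwap i from Equiv.swap_inv _ _]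

theorem row_simpleSwap_of_eq {t : Tableau n lam} {i : Fin (n - 1)}
    (hi' : t.row (lo i) = t.row (hi i)) (j : Fin n) : t.row (simpleSwap i j) = t.row j := by
  simp only [simpleSwap, Equiv.swap_apply_def]
  split_ifs with h h'
  · rw [h, hi']
  · rw [h', hi']
  · rfl

/-- If `i` and `i + 1` lie in one row of the standard tableau `t`, then applying `s_i` after a
column permutation still makes the row word larger. -/
theorem IsStandard.row_lt_swap_smul {t : Tableau n lam} (ht : t.IsStandard) {i : Fin (n - 1)}
    (hi' : t.row (lo i) = t.row (hi i)) {σ : Perm (Fin n)} (hσ : σ ∈ t.colStab) (h1 : σ ≠ 1) :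
    toLex t.row < toLex (simpleSwap i • σ • t).row := by
  obtain ⟨k, hk, hlt⟩ := ht.row_lt_smul hσ h1
  replace hk : ∀ j < k, t.row j = (σ • t).row j := hk
  replace hlt : t.row k < (σ • t).row k := hlt
  rcases lt_trichotomy k (lo i) with h | h | h
  · refine ⟨k, fun j hj => ?_, ?_⟩
    · change t.row j = (simpleSwap i • σ • t).row j
      rw [row_simpleSwap_smul, simpleSwap_of_lt (hj.trans h), hk j hj]
    · change t.row k < (simpleSwap i • σ • t).row k
      rwa [row_simpleSwap_smul, simpleSwap_of_lt h]
  · have hle : t.row (hi i) ≤ (σ • t).row (hi i) := by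
      refine ht.le_row_smul hσ (fun j hj => (hk j hj).symm) fun j hj hr => ?_
      refine lt_of_le_of_ne ?_ fun hjk => ?_
      · rw [h, Fin.le_def]
        have := Fin.lt_def.1 hj
        simp only [lo, hi] at this ⊢
        omega
      · rw [hjk, h, hi'] at hr
        exact lt_irrefl _ hr
    have hlow : ∀ j < lo i, t.row j = (simpleSwap i • σ • t).row j := fun j hj => by
      rw [row_simpleSwap_smul, simpleSwap_of_lt hj, hk j (h ▸ hj)]
    rcases hle.lt_or_eq with h2 | h2
    · refine ⟨lo i, hlow, ?_⟩
      change t.row (lo i) < (simpleSwap i • σ • t).row (lo i)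
      rwa [row_simpleSwap_smul, simpleSwap_lo, hi']
    · refine ⟨hi i, fun j hj => ?_, ?_⟩
      · change t.row j = (simpleSwap i • σ • t).row j
        rcases lt_or_ge j (lo i) with h3 | h3
        · exact hlow j h3
        · have : j = lo i := by
            have hj' := Fin.lt_def.1 hj
            have h3' := Fin.le_def.1 h3
            simp only [lo, hi] at hj' h3'
            exact Fin.ext (by simp only [lo]; omega)
          rw [this, row_simpleSwap_smul, simpleSwap_lo, ← h2, hi']
      · change t.row (hi i) < (simpleSwap i • σ • t).row (hi i)
        rwa [row_simpleSwap_smul, simpleSwap_hi, ← hi', ← h]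
  · have h' : hi i ≤ k := by
      rw [Fin.le_def]
      have := Fin.lt_def.1 h
      simp only [lo, hi] at this ⊢
      omega
    rcases h'.lt_or_eq with h2 | h2
    · refine ⟨k, fun j hj => ?_, ?_⟩
      · change t.row j = (simpleSwap i • σ • t).row j
        rw [row_simpleSwap_smul, ← hk, row_simpleSwap_of_eq hi']
        simp only [simpleSwap, Equiv.swap_apply_def]
        split_ifs <;> assumption
      · change t.row k < (simpleSwap i • σ • t).row k
        rwa [row_simpleSwap_smul, simpleSwap_of_gt h2]
    · refine ⟨lo i, fun j hj => ?_, ?_⟩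
      · change t.row j = (simpleSwap i • σ • t).row j
        rw [row_simpleSwap_smul, simpleSwap_of_lt hj, hk j (hj.trans h)]
      · change t.row (lo i) < (simpleSwap i • σ • t).row (lo i)
        rwa [row_simpleSwap_smul, simpleSwap_lo, h2, hi', h2]

end Tableau

theorem SYT.polytabloid_apply_self (T : SYT n lam) : T.1.polytabloid T.1.tabloid = 1 := by
  classical
  rw [polytabloid_apply, Finset.sum_eq_single 1]
  · simp
  · intro σ hσ h1
    refine if_neg fun h => h1 ?_
    exact Tableau.eq_one_of_row_eq (Finset.mem_filter.1 hσ).2 (Tableau.tabloid_eq_iff.1 h)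
  · intro h
    exact absurd (Finset.mem_filter.2 ⟨Finset.mem_univ _, one_mem _⟩) h

theorem SYT.word_le_of_polytabloid_ne (T : SYT n lam) {x : Tabloid n lam}
    (h : T.1.polytabloid x ≠ 0) : T.word ≤ x.word := by
  classical
  rw [polytabloid_apply] at h
  obtain ⟨σ, hσ, h1⟩ := Finset.exists_ne_zero_of_sum_ne_zero h
  obtain rfl : (σ • T.1).tabloid = x := by
    by_contra hcon
    exact h1 (if_neg hcon)
  exact T.2.row_le_smul (Finset.mem_filter.1 hσ).2

/-- The matrix of coefficients of `e_T` at the standard tabloids is unitriangular. -/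
theorem SYT.polytabloid_apply_of_lt {S T : SYT n lam} (h : S < T) :
    T.1.polytabloid S.1.tabloid = 0 := by
  by_contra hcon
  exact absurd (T.word_le_of_polytabloid_ne hcon) (not_le.2 h)

/-- If `i` and `i + 1` lie in one row of `T`, then `s_i e_T` still starts with `{T}`. -/
theorem SYT.permRep_swap_apply_self {T : SYT n lam} {i : Fin (n - 1)}
    (hi' : T.1.row (lo i) = T.1.row (hi i)) :
    permRep n lam (simpleSwap i) T.1.polytabloid T.1.tabloid = 1 := by
  classical
  rw [permRep_polytabloid_apply, Finset.sum_eq_single 1]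
  · rw [if_pos, Perm.sign_one]
    · simp
    · rw [one_smul, Tableau.tabloid_eq_iff]
      intro j
      rw [Tableau.row_simpleSwap_smul, Tableau.row_simpleSwap_of_eq hi']
  · intro σ hσ h1
    refine if_neg fun h => ?_
    refine (T.2.row_lt_swap_smul hi' (Finset.mem_filter.1 hσ).2 h1).ne ?_
    exact congrArg Tabloid.word h.symm
  · intro h
    exact absurd (Finset.mem_filter.2 ⟨Finset.mem_univ _, one_mem _⟩) h

theorem SYT.permRep_swap_apply_of_lt {S T : SYT n lam} {i : Fin (n - 1)}
    (hi' : T.1.row (lo i) = T.1.row (hi i)) (hST : S < T) :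
    permRep n lam (simpleSwap i) T.1.polytabloid S.1.tabloid = 0 := by
  classical
  rw [permRep_polytabloid_apply]
  refine Finset.sum_eq_zero fun σ hσ => if_neg fun h => ?_
  have h2 : toLex (simpleSwap i • σ • T.1).row = S.word := congrArg Tabloid.word h
  rcases eq_or_ne σ 1 with rfl | h1
  · have h3 : toLex (simpleSwap i • (1 : Perm (Fin n)) • T.1).row = T.word := by
      refine congrArg toLex (funext fun j => ?_)
      rw [one_smul, Tableau.row_simpleSwap_smul, Tableau.row_simpleSwap_of_eq hi']
    exact hST.ne (SYT.word_injective (h2.symm.trans h3))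
  · have h3 := T.2.row_lt_swap_smul hi' (Finset.mem_filter.1 hσ).2 h1
    rw [h2] at h3
    exact lt_asymm hST h3

/-! ### Highest weight vectors in tensor powers -/

section HighestWeight

variable {ι α : Type*} [Fintype ι] [DecidableEq ι] [DecidableEq α]

/-- The operator of the matrix unit `E_{ab}` on a tensor power of `ℂ^α`, a vector being given by its
coefficients at the words `ι → α`. -/
def raise (a b : α) (v : (ι → α) → ℂ) (u : ι → α) : ℂ :=
  ∑ k with u k = a, v (Function.update u k b)

theorem raise_raise {a b : α} (hab : a ≠ b) (v : (ι → α) → ℂ) (w : ι → α) :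
    raise a b (raise b a v) w = (Finset.univ.filter fun k => w k = a).card * v w +
      ∑ k with w k = a, ∑ l with w l = b, v (Function.update (Function.update w k b) l a) := by
  have h : ∀ k ∈ Finset.univ.filter fun k => w k = a, raise b a v (Function.update w k b) =
      v w + ∑ l with w l = b, v (Function.update (Function.update w k b) l a) := by
    intro k hk
    have hk' : w k = a := (Finset.mem_filter.1 hk).2
    have hset : (Finset.univ.filter fun l => Function.update w k b l = b) =
        insert k (Finset.univ.filter fun l => w l = b) := by
      ext l
      by_cases hl : l = k
      · simp [hl]
      · simp [hl]
    rw [raise, hset, Finset.sum_insert (by simpa [hk'] using hab), Function.update_idem,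
      Function.update_eq_self_iff.2 hk'.symm]
  rw [raise, Finset.sum_congr rfl h, Finset.sum_add_distrib, Finset.sum_const, nsmul_eq_mul]

theorem raise_raise_sub {a b : α} (hab : a ≠ b) (v : (ι → α) → ℂ) (w : ι → α) :
    raise a b (raise b a v) w - raise b a (raise a b v) w =
      ((Finset.univ.filter fun k => w k = a).card -
        (Finset.univ.filter fun k => w k = b).card) * v w := by
  rw [raise_raise hab, raise_raise hab.symm]
  have : ∑ k with w k = a, ∑ l with w l = b, v (Function.update (Function.update w k b) l a) =
      ∑ l with w l = b, ∑ k with w k = a, v (Function.update (Function.update w l a) k b) := by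
    rw [Finset.sum_comm]
    refine Finset.sum_congr rfl fun l hl => Finset.sum_congr rfl fun k hk => ?_
    rw [Function.update_comm]
    rintro rfl
    exact hab ((Finset.mem_filter.1 hk).2.symm.trans (Finset.mem_filter.1 hl).2)
  rw [this]
  ring

variable [Fintype α]

theorem sum_mul_raise (a b : α) (f v : (ι → α) → ℂ) :
    ∑ u, f u * raise b a v u = ∑ w, raise a b f w * v w := by
  simp only [raise, Finset.mul_sum, Finset.sum_mul]
  rw [Finset.sum_sigma', Finset.sum_sigma']
  refine Finset.sum_bij' (fun p _ => ⟨Function.update p.1 p.2 a, p.2⟩)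
    (fun p _ => ⟨Function.update p.1 p.2 b, p.2⟩) ?_ ?_ ?_ ?_ ?_
  · simp
  · simp
  · rintro ⟨u, k⟩ h
    simp only [Finset.mem_sigma, Finset.mem_filter, Finset.mem_univ, true_and] at h
    simp [← h]
  · rintro ⟨u, k⟩ h
    simp only [Finset.mem_sigma, Finset.mem_filter, Finset.mem_univ, true_and] at h
    simp [← h]
  · rintro ⟨u, k⟩ h
    simp only [Finset.mem_sigma, Finset.mem_filter, Finset.mem_univ, true_and] at h
    simp [← h]

/-- A vector killed by `E_{ab}` whose words hold `b` more often than `a` vanishes: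
by `[E_{ab}, E_{ba}] = E_{aa} - E_{bb}` its image under `E_{ba}` would have negative square norm. -/
theorem eq_zero_of_raise_eq_zero {a b : α} (hab : a ≠ b) (v : (ι → α) → ℂ) (hE : raise a b v = 0)
    (hc : ∀ w, v w ≠ 0 → (Finset.univ.filter fun k => w k = a).card <
      (Finset.univ.filter fun k => w k = b).card) : v = 0 := by
  have h1 : ∑ u, ‖raise b a v u‖ ^ 2 = ∑ w, (((Finset.univ.filter fun k => w k = a).card : ℝ) -
      (Finset.univ.filter fun k => w k = b).card) * ‖v w‖ ^ 2 := by
    have h := sum_mul_raise a b (fun u => (starRingEnd ℂ) (raise b a v u)) v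
    have h2 : ∀ w, raise a b (fun u => (starRingEnd ℂ) (raise b a v u)) w =
        (starRingEnd ℂ) (raise a b (raise b a v) w) := by
      intro w
      simp [raise]
    have h3 : ∀ w, raise a b (raise b a v) w = ((Finset.univ.filter fun k => w k = a).card -
        (Finset.univ.filter fun k => w k = b).card) * v w := by
      intro w
      rw [← raise_raise_sub hab, hE]
      simp [raise]
    simp only [h2, h3] at h
    have h4 : ((∑ u, ‖raise b a v u‖ ^ 2 : ℝ) : ℂ) =
        ((∑ w, (((Finset.univ.filter fun k => w k = a).card : ℝ) -
          (Finset.univ.filter fun k => w k = b).card) * ‖v w‖ ^ 2 : ℝ) : ℂ) := by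
      push_cast
      simp only [← Complex.conj_mul', ← mul_assoc]
      rw [h]
      refine Finset.sum_congr rfl fun w _ => ?_
      simp
    exact_mod_cast h4
  have h2 : ∀ w ∈ Finset.univ, (((Finset.univ.filter fun k => w k = a).card : ℝ) -
      (Finset.univ.filter fun k => w k = b).card) * ‖v w‖ ^ 2 ≤ 0 := by
    intro w _
    by_cases hw : v w = 0
    · simp [hw]
    · refine mul_nonpos_of_nonpos_of_nonneg ?_ (by positivity)
      have := hc w hw
      have : ((Finset.univ.filter fun k => w k = a).card : ℝ) <
        (Finset.univ.filter fun k => w k = b).card := by exact_mod_cast this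
      linarith
  have h3 : ∑ w, (((Finset.univ.filter fun k => w k = a).card : ℝ) -
      (Finset.univ.filter fun k => w k = b).card) * ‖v w‖ ^ 2 = 0 :=
    le_antisymm (Finset.sum_nonpos h2) (h1 ▸ Finset.sum_nonneg fun _ _ => by positivity)
  ext w
  by_contra hw
  have h4 := (Finset.sum_eq_zero_iff_of_nonpos h2).1 h3 w (Finset.mem_univ w)
  have h5 : ((Finset.univ.filter fun k => w k = a).card : ℝ) <
    (Finset.univ.filter fun k => w k = b).card := by exact_mod_cast hc w hw
  rcases mul_eq_zero.1 h4 with h | h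
  · linarith
  · exact hw (by simpa using h)

end HighestWeight

/-- A lattice word: every prefix holds each letter at least as often as every larger one. -/
def IsLattice {α : Type*} [LinearOrder α] {n : ℕ} (w : Fin n → α) : Prop :=
  ∀ m : ℕ, ∀ a b : α, a < b → (Finset.univ.filter fun k : Fin n => k.1 < m ∧ w k = b).card ≤
    (Finset.univ.filter fun k : Fin n => k.1 < m ∧ w k = a).card

/-- A nonzero highest weight vector involves a lattice word.  For the largest possible last letter
`r`, the part of the vector that ends in `r` is again a highest weight vector; append `r` to one of
its lattice words.  The prefix condition for the full word holds by
`eq_zero_of_raise_eq_zero`. -/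
theorem exists_isLattice {α : Type*} [LinearOrder α] [Fintype α] (n : ℕ) :
    ∀ (v : (Fin n → α) → ℂ) (c : α → ℕ),
      (∀ w, v w ≠ 0 → ∀ a, (Finset.univ.filter fun k => w k = a).card = c a) →
      (∀ a b, a < b → raise a b v = 0) → v ≠ 0 → ∃ w, v w ≠ 0 ∧ IsLattice w := by
  induction n with
  | zero =>
    intro v c _ _ hv
    obtain ⟨w, hw⟩ := Function.ne_iff.1 hv
    exact ⟨w, hw, fun m a b _ => by simp⟩
  | succ n ih =>
    intro v c hc hE hv
    have hdom : ∀ a b, a < b → c b ≤ c a := by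
      intro a b hab
      by_contra hcon
      exact hv (eq_zero_of_raise_eq_zero hab.ne v (hE a b hab) fun w hw => by
        rw [hc w hw, hc w hw]
        exact not_le.1 hcon)
    obtain ⟨r, ⟨u₀, hu₀⟩, hmax⟩ : ∃ r : α, (∃ u : Fin n → α, v (Fin.snoc u r) ≠ 0) ∧
        ∀ s, r < s → ∀ u : Fin n → α, v (Fin.snoc u s) = 0 := by
      classical
      obtain ⟨w, hw⟩ := Function.ne_iff.1 hv
      have hne : (Finset.univ.filter fun r : α =>
          ∃ u : Fin n → α, v (Fin.snoc u r) ≠ 0).Nonempty :=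
        ⟨w (Fin.last n), by
          simpa using ⟨Fin.init w, by simpa using hw⟩⟩
      refine ⟨Finset.max' _ hne, (Finset.mem_filter.1 (Finset.max'_mem _ hne)).2, ?_⟩
      intro s hs u
      by_contra hcon
      exact not_le.2 hs (Finset.le_max' _ s (by simpa using ⟨u, hcon⟩))
    have hcount : ∀ (u : Fin n → α) (a : α),
        (Finset.univ.filter fun k => (Fin.snoc u r : Fin (n + 1) → α) k = a).card =
          (Finset.univ.filter fun k => u k = a).card + if r = a then 1 else 0 := by
      intro u a
      simp only [Finset.card_filter, Fin.sum_univ_castSucc, Fin.snoc_castSucc, Fin.snoc_last]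
    obtain ⟨u, hu, hlat⟩ := ih (fun u => v (Fin.snoc u r)) (fun a => c a - if r = a then 1 else 0)
      (fun w hw a => by rw [← hc _ hw a, hcount]; simp)
      (fun a b hab => by
        ext u
        have h := congrFun (hE a b hab) (Fin.snoc u r)
        rw [raise, Finset.sum_filter, Fin.sum_univ_castSucc] at h
        simp only [Fin.snoc_castSucc, Fin.snoc_last, Fin.update_snoc_last,
          ← Fin.snoc_update] at h
        rw [raise, Finset.sum_filter]
        -- the move of the last letter contributes nothing, as `r` is the largest last letter
        have h0 : (if r = a then v (Fin.snoc u b) else 0) = 0 := by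
          split_ifs with hra
          · exact hmax b (hra ▸ hab) u
          · rfl
        rw [h0, add_zero] at h
        exact h)
      (Function.ne_iff.2 ⟨u₀, hu₀⟩)
    refine ⟨Fin.snoc u r, hu, fun m a b hab => ?_⟩
    rcases le_or_gt m n with hm | hm
    · have hsnoc : ∀ a : α, (Finset.univ.filter fun k : Fin (n + 1) =>
          k.1 < m ∧ (Fin.snoc u r : Fin (n + 1) → α) k = a).card =
          (Finset.univ.filter fun k : Fin n => k.1 < m ∧ u k = a).card := by
        intro a
        simp only [Finset.card_filter, Fin.sum_univ_castSucc, Fin.snoc_castSucc, Fin.val_castSucc,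
          Fin.val_last, not_lt.2 hm, false_and, if_false, add_zero]
      rw [hsnoc, hsnoc]
      exact hlat m a b hab
    · have hall : ∀ a : α, (Finset.univ.filter fun k : Fin (n + 1) =>
          k.1 < m ∧ (Fin.snoc u r : Fin (n + 1) → α) k = a).card = c a := by
        intro a
        rw [← hc _ hu a]
        congr 1
        ext k
        simp only [Finset.mem_filter, Finset.mem_univ, true_and, and_iff_right_iff_imp]
        intro _
        have := k.2
        omega
      rw [hall, hall]
      exact hdom a b hab

/-! ### The standard polytabloids form a basis of the Specht module -/

namespace Tableau

theorem card_row_eq (t : Tableau n lam) (r : ℕ) :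
    (Finset.univ.filter fun k => t.row k = r).card = lam.rowLen r := by
  rw [← Finset.card_range (lam.rowLen r)]
  refine Finset.card_bij (fun k _ => t.col k) ?_ ?_ ?_
  · intro k hk
    rw [Finset.mem_range, ← YoungDiagram.mem_iff_lt_rowLen, ← (Finset.mem_filter.1 hk).2]
    exact t.pos_mem k
  · intro a ha b hb hab
    exact t.eq_of_row_col ((Finset.mem_filter.1 ha).2.trans (Finset.mem_filter.1 hb).2.symm) hab
  · intro c hc
    rw [Finset.mem_range, ← YoungDiagram.mem_iff_lt_rowLen] at hc
    obtain ⟨k, hk⟩ := t.exists_pos hc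
    exact ⟨k, Finset.mem_filter.2 ⟨Finset.mem_univ _, (congrArg Prod.fst hk :)⟩,
      (congrArg Prod.snd hk :)⟩

theorem row_lt (t : Tableau n lam) (k : Fin n) : t.row k < lam.colLen 0 := by
  rw [← YoungDiagram.mem_iff_lt_colLen]
  exact lam.up_left_mem le_rfl (Nat.zero_le _) (t.pos_mem k)

end Tableau

/-- Lattice words whose content is the shape are the row words of standard tableaux. -/
theorem exists_SYT_of_isLattice (hlam : lam.card = n) {R : ℕ} (w : Fin n → Fin R)
    (hc : ∀ r : ℕ, (Finset.univ.filter fun k => (w k : ℕ) = r).card = lam.rowLen r)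
    (hw : IsLattice w) : ∃ T : SYT n lam, ∀ k, T.1.row k = w k := by
  -- the column of `k` is the number of earlier occurrences of the letter `w k`
  set col : Fin n → ℕ := fun k => (Finset.univ.filter fun j => j < k ∧ w j = w k).card with hcol
  have hmono : ∀ a b, w a = w b → a < b → col a < col b := by
    intro a b hab hlt
    refine Finset.card_lt_card ⟨fun j hj => ?_, fun h => ?_⟩
    · simp only [Finset.mem_filter, Finset.mem_univ, true_and] at hj ⊢
      exact ⟨hj.1.trans hlt, hj.2.trans hab⟩
    · have : a ∈ Finset.univ.filter fun j => j < a ∧ w j = w a := h (by simp [hlt, hab])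
      simp at this
  have hmem : ∀ k, ((w k : ℕ), col k) ∈ lam.cells := by
    intro k
    rw [YoungDiagram.mem_cells, YoungDiagram.mem_iff_lt_rowLen, ← hc]
    refine Finset.card_lt_card ⟨fun j hj => ?_, fun h => ?_⟩
    · simp only [Finset.mem_filter, Finset.mem_univ, true_and] at hj ⊢
      rw [hj.2]
    · have : k ∈ Finset.univ.filter fun j => j < k ∧ w j = w k := h (by simp)
      simp at this
  have hinj : Function.Injective
      (fun k => (⟨((w k : ℕ), col k), hmem k⟩ : {c : ℕ × ℕ // c ∈ lam.cells})) := by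
    intro a b hab
    have h := congrArg Subtype.val hab
    have h1 : w a = w b := Fin.ext (congrArg Prod.fst h :)
    have h2 : col a = col b := (congrArg Prod.snd h :)
    rcases lt_trichotomy a b with h3 | h3 | h3
    · exact absurd h2 (hmono a b h1 h3).ne
    · exact h3
    · exact absurd h2 (hmono b a h1.symm h3).ne'
  have hbij := (Fintype.bijective_iff_injective_and_card _).2 ⟨hinj, by
    rw [Fintype.card_fin, Fintype.card_coe]; exact hlam.symm⟩
  refine ⟨⟨(Equiv.ofBijective _ hbij : Fin n ≃ {c : ℕ × ℕ // c ∈ lam.cells}), ?_, ?_⟩,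
    fun k => rfl⟩
  · intro a b (h1 : (w a : ℕ) = w b) (h2 : col a < col b)
    by_contra hcon
    rcases (not_lt.1 hcon).lt_or_eq with h3 | h3
    · exact lt_asymm h2 (hmono b a (Fin.ext h1.symm) h3)
    · exact h2.ne (by rw [h3])
  · intro a b (h1 : col a = col b) (h2 : (w a : ℕ) < w b)
    by_contra hcon
    have hba : b < a := lt_of_le_of_ne (not_lt.1 hcon) fun h => by
      rw [h] at h2
      exact lt_irrefl _ h2
    have h3 := hw (b.1 + 1) (w a) (w b) (Fin.lt_def.2 h2)
    have h4 : (Finset.univ.filter fun k : Fin n => k.1 < b.1 + 1 ∧ w k = w b).card =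
        col b + 1 := by
      rw [hcol, ← Finset.card_insert_of_notMem (a := b) (by simp)]
      congr 1
      ext k
      simp only [Finset.mem_filter, Finset.mem_univ, true_and, Finset.mem_insert, Nat.lt_succ_iff,
        le_iff_eq_or_lt]
      constructor
      · rintro ⟨h | h, h'⟩
        · exact Or.inl (Fin.ext h)
        · exact Or.inr ⟨h, h'⟩
      · rintro (rfl | h)
        · exact ⟨Or.inl rfl, rfl⟩
        · exact ⟨Or.inr h.1, h.2⟩
    have h5 : (Finset.univ.filter fun k : Fin n => k.1 < b.1 + 1 ∧ w k = w a).card ≤ col a := by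
      refine Finset.card_le_card fun k hk => ?_
      simp only [Finset.mem_filter, Finset.mem_univ, true_and] at hk ⊢
      exact ⟨lt_of_le_of_lt (Fin.le_def.2 (Nat.lt_succ_iff.1 hk.1)) hba, hk.2⟩
    omega

/-- The coefficients of a vector of `M^lam` at words in the row indices. -/
def wordCoeff (n : ℕ) (lam : YoungDiagram) (R : ℕ) :
    PermModule n lam →ₗ[ℂ] ((Fin n → Fin R) → ℂ) where
  toFun v w := Finsupp.mapDomain Tabloid.word v (toLex fun k => (w k : ℕ))
  map_add' v v' := by ext; simp [Finsupp.mapDomain_add]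
  map_smul' c v := by ext; simp [Finsupp.mapDomain_smul]

theorem wordCoeff_of_word_eq {R : ℕ} (v : PermModule n lam) {w : Fin n → Fin R} {x : Tabloid n lam}
    (h : x.word = toLex fun k => (w k : ℕ)) : wordCoeff n lam R v w = v x := by
  change Finsupp.mapDomain Tabloid.word v (toLex fun k => (w k : ℕ)) = _
  rw [← h, Finsupp.mapDomain_apply Tabloid.word_injective]

theorem exists_of_wordCoeff_ne_zero {R : ℕ} {v : PermModule n lam} {w : Fin n → Fin R}
    (h : wordCoeff n lam R v w ≠ 0) : ∃ t : Tableau n lam, ∀ k, t.row k = w k := by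
  by_contra hcon
  refine h (Finsupp.mapDomain_of_notMem_range _ _ ?_)
  rintro ⟨x, hx⟩
  induction x using Quotient.inductionOn with
  | h t => exact hcon ⟨t, fun k => congrFun (toLex.injective hx) k⟩

open Classical in
theorem wordCoeff_polytabloid {R : ℕ} (t : Tableau n lam) (w : Fin n → Fin R) :
    wordCoeff n lam R t.polytabloid w = ∑ σ ∈ Finset.univ.filter (· ∈ t.colStab),
      if ∀ k, (σ • t).row k = w k then ((Perm.sign σ : ℤ) : ℂ) else 0 := by
  unfold Tableau.polytabloid
  rw [map_sum, Finset.sum_apply]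
  refine Finset.sum_congr rfl fun σ _ => ?_
  change Finsupp.mapDomain Tabloid.word (Finsupp.single _ _) _ = _
  rw [Finsupp.mapDomain_single, Finsupp.single_apply]
  refine if_congr ?_ rfl rfl
  exact ⟨fun h k => congrFun (toLex.injective h) k, fun h => congrArg toLex (funext h)⟩

/-- Polytabloids are highest weight vectors.  In `E_{ab} e_t` a term of `e_t` whose letter `k` has
been moved from row `b` to row `a` cancels against the one where `k` and the letter `l` in row `a`
and the column of `k` have been exchanged and `l` has been moved. -/
theorem raise_wordCoeff_polytabloid {R : ℕ} (t : Tableau n lam) {a b : Fin R} (hab : a < b) :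
    raise a b (wordCoeff n lam R t.polytabloid) = 0 := by
  classical
  ext u
  simp only [raise, wordCoeff_polytabloid, Pi.zero_apply]
  rw [← Finset.sum_product', ← Finset.sum_filter]
  set s := ((Finset.univ.filter fun k => u k = a) ×ˢ
    (Finset.univ.filter (· ∈ t.colStab))).filter fun p : Fin n × Perm (Fin n) =>
      ∀ k, (p.2 • t).row k = (Function.update u p.1 b k : Fin R) with hs
  have hex : ∀ p : Fin n × Perm (Fin n), ∃ l, p ∈ s →
      (p.2 • t).pos l = ((a : ℕ), t.col p.1) := by
    rintro ⟨k, σ⟩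
    by_cases hp : (k, σ) ∈ s
    swap
    · exact ⟨k, fun h => absurd h hp⟩
    simp only [hs, Finset.mem_filter, Finset.mem_product, Finset.mem_univ, true_and] at hp
    refine ((σ • t).exists_pos (lam.up_left_mem (Fin.le_def.1 hab.le) le_rfl ?_)).imp fun _ h _ => h
    have := (σ • t).pos_mem k
    rw [Tableau.pos_smul_of_mem hp.1.2, hp.2 k, Function.update_self] at this
    exact this
  choose l hl using hex
  have key : ∀ p ∈ s,
      l p ≠ p.1 ∧ (swap p.1 (l p) • p.2 • t).pos p.1 = ((a : ℕ), t.col p.1) ∧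
      t.col (l p) = t.col p.1 ∧
      ((l p, swap p.1 (l p) * p.2) ∈ s) := by
    rintro ⟨k, σ⟩ hp
    have hpos := hl _ hp
    simp only at hpos ⊢
    generalize l (k, σ) = m at hpos
    simp only [hs, Finset.mem_filter, Finset.mem_product, Finset.mem_univ, true_and] at hp ⊢
    obtain ⟨⟨huk, hσ⟩, hrow⟩ := hp
    have hmr : (σ • t).row m = a := (congrArg Prod.fst hpos :)
    have hmc : t.col m = t.col k := by
      rw [Tableau.pos_smul_of_mem hσ] at hpos
      exact (congrArg Prod.snd hpos :)
    have hmk : m ≠ k := by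
      rintro rfl
      have := hrow m
      rw [Function.update_self, hmr] at this
      exact hab.ne (Fin.ext this)
    have hum : u m = a := by
      have := hrow m
      rw [Function.update_of_ne hmk, hmr] at this
      exact (Fin.ext this).symm
    refine ⟨hmk, ?_, hmc, ⟨hum, ?_⟩, ?_⟩
    · rw [Tableau.pos_smul, Equiv.swap_inv, Equiv.swap_apply_left]
      exact hpos
    · refine mul_mem ?_ hσ
      intro x
      simp only [Equiv.swap_apply_def]
      split_ifs with h h'
      · rw [h, hmc]
      · rw [h', hmc]
      · rfl
    · intro x
      rw [mul_smul, Tableau.row_smul, Equiv.swap_inv]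
      by_cases h1 : x = k
      · rw [h1, Equiv.swap_apply_left, hmr, Function.update_of_ne hmk.symm, huk]
      · by_cases h2 : x = m
        · rw [h2, Equiv.swap_apply_right, hrow, Function.update_self, Function.update_self]
        · rw [Equiv.swap_apply_of_ne_of_ne h1 h2, hrow, Function.update_of_ne h1,
            Function.update_of_ne h2]
  refine Finset.sum_involution (fun p _ => (l p, swap p.1 (l p) * p.2)) ?_ ?_ ?_ ?_
  · intro p hp
    rw [map_mul, Perm.sign_swap (key p hp).1.symm]
    simp
  · intro p hp _ h
    exact (key p hp).1 (congrArg Prod.fst h)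
  · intro p hp
    exact (key p hp).2.2.2
  · intro p hp
    have h1 := hl _ (key p hp).2.2.2
    have h2 : l (l p, swap p.1 (l p) * p.2) = p.1 := by
      refine Tableau.pos_injective _ (h1.trans ?_)
      rw [mul_smul, (key p hp).2.1, (key p hp).2.2.1]
    refine Prod.ext h2 ?_
    change swap (l p) (l (l p, swap p.1 (l p) * p.2)) * (swap p.1 (l p) * p.2) = p.2
    rw [h2, Equiv.swap_comm, ← mul_assoc, Equiv.swap_mul_self, one_mul]

theorem raise_wordCoeff {R : ℕ} {a b : Fin R} (hab : a < b) (v : PermModule n lam)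
    (hv : v ∈ (spechtSub n lam).toSubmodule) : raise a b (wordCoeff n lam R v) = 0 := by
  change v ∈ Submodule.span ℂ _ at hv
  induction hv using Submodule.span_induction with
  | mem x hx =>
    obtain ⟨t, rfl⟩ := hx
    exact raise_wordCoeff_polytabloid t hab
  | zero => ext u; simp [raise]
  | add x y _ _ hx hy =>
    ext u
    have h1 := congrFun hx u
    have h2 := congrFun hy u
    simp only [raise, Pi.zero_apply, map_add, Pi.add_apply, Finset.sum_add_distrib] at h1 h2 ⊢
    rw [h1, h2, add_zero]
  | smul c x _ hx =>
    ext u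
    have h1 := congrFun hx u
    simp only [raise, Pi.zero_apply, map_smul, Pi.smul_apply, ← Finset.smul_sum] at h1 ⊢
    rw [h1, smul_zero]

/-- An element of the Specht module is determined by its coefficients at the standard tabloids. -/
theorem eq_zero_of_forall_SYT (hlam : lam.card = n) {v : PermModule n lam}
    (hv : v ∈ (spechtSub n lam).toSubmodule) (h : ∀ T : SYT n lam, v T.1.tabloid = 0) : v = 0 := by
  by_contra hne
  obtain ⟨x, hx⟩ := Finsupp.ne_iff.1 hne
  have hf : wordCoeff n lam (lam.colLen 0) v ≠ 0 := by
    induction x using Quotient.inductionOn with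
    | h t =>
      refine Function.ne_iff.2 ⟨fun k => ⟨t.row k, t.row_lt k⟩, ?_⟩
      rwa [wordCoeff_of_word_eq v (x := t.tabloid) rfl]
  obtain ⟨w, hw, hlat⟩ := exists_isLattice n (wordCoeff n lam (lam.colLen 0) v)
    (fun a => lam.rowLen a) (fun w hw a => by
      obtain ⟨t, ht⟩ := exists_of_wordCoeff_ne_zero hw
      rw [← t.card_row_eq]
      congr 1
      ext k
      simp [ht k, Fin.ext_iff])
    (fun a b hab => raise_wordCoeff hab v hv) hf
  obtain ⟨t, ht⟩ := exists_of_wordCoeff_ne_zero hw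
  obtain ⟨T, hT⟩ := exists_SYT_of_isLattice hlam w
    (fun r => by
      rw [← t.card_row_eq]
      congr 1
      ext k
      simp [ht k]) hlat
  refine hw ?_
  rw [wordCoeff_of_word_eq v (x := T.1.tabloid) (congrArg toLex (funext hT)), h T]

/-- A family of vectors is independent if linear functionals detect its members in a triangular
way with respect to a statistic `s`. -/
theorem linearIndependent_of_triangular {ι V α : Type*} [AddCommGroup V] [Module ℂ V] [Finite ι]
    [LinearOrder α] (v : ι → V) (φ : ι → V →ₗ[ℂ] ℂ) (s : ι → α) (h1 : ∀ i, φ i (v i) ≠ 0)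
    (h2 : ∀ i j, φ i (v j) ≠ 0 → j = i ∨ s j < s i) : LinearIndependent ℂ v := by
  classical
  have := Fintype.ofFinite ι
  rw [Fintype.linearIndependent_iff]
  intro c hc i₀
  by_contra hne
  obtain ⟨i, hi, hmin⟩ := Finset.exists_min_image (Finset.univ.filter fun i => c i ≠ 0) s
    ⟨i₀, by simpa using hne⟩
  have h := congrArg (φ i) hc
  rw [map_sum, map_zero, Finset.sum_eq_single i] at h
  · rw [map_smul, smul_eq_mul] at h
    exact (mul_ne_zero (Finset.mem_filter.1 hi).2 (h1 i)) h
  · intro j _ hji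
    rw [map_smul, smul_eq_mul]
    by_contra hcon
    have hj := hmin j (by simpa using left_ne_zero_of_mul hcon)
    rcases h2 i j (right_ne_zero_of_mul hcon) with h3 | h3
    · exact hji h3
    · exact not_le.2 h3 hj
  · simp

/-- The coefficient at the tabloid `x`, as a functional on the Specht module. -/
def coeffAt (x : Tabloid n lam) : Specht n lam →ₗ[ℂ] ℂ :=
  (Finsupp.lapply x).comp (spechtSub n lam).toSubmodule.subtype

theorem coeffAt_polytabloidSpecht (x : Tabloid n lam) (t : Tableau n lam) :
    coeffAt x t.polytabloidSpecht = t.polytabloid x := rfl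

theorem spechtRep_polytabloidSpecht (σ : Perm (Fin n)) (t : Tableau n lam) :
    spechtRep n lam σ t.polytabloidSpecht = (σ • t).polytabloidSpecht :=
  Subtype.ext (permRep_polytabloid σ t)

theorem coeffAt_spechtRep_polytabloidSpecht (σ : Perm (Fin n)) (x : Tabloid n lam)
    (t : Tableau n lam) : coeffAt x (spechtRep n lam σ t.polytabloidSpecht) =
      permRep n lam σ t.polytabloid x := rfl

theorem linearIndependent_polytabloid :
    LinearIndependent ℂ fun T : SYT n lam => T.1.polytabloidSpecht := by
  refine linearIndependent_of_triangular _ (fun T => coeffAt T.1.tabloid) id (fun T => ?_)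
    fun S T h => ?_
  · rw [coeffAt_polytabloidSpecht, SYT.polytabloid_apply_self]
    exact one_ne_zero
  · by_contra hcon
    rw [not_or] at hcon
    refine h (SYT.polytabloid_apply_of_lt ?_)
    exact lt_of_le_of_ne (not_lt.1 hcon.2) (Ne.symm hcon.1)

theorem finrank_specht_le (hlam : lam.card = n) :
    Module.finrank ℂ (Specht n lam) ≤ Fintype.card (SYT n lam) := by
  have hinj : Function.Injective
      (LinearMap.pi fun T : SYT n lam => coeffAt (n := n) (lam := lam) T.1.tabloid) := by
    rw [← LinearMap.ker_eq_bot, LinearMap.ker_eq_bot']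
    intro v hv
    exact Subtype.ext (eq_zero_of_forall_SYT hlam v.2 fun T => congrFun hv T)
  simpa using LinearMap.finrank_le_finrank_of_injective hinj

/-- The basis of standard polytabloids. -/
def spechtBasis (hlam : lam.card = n) : Module.Basis (SYT n lam) ℂ (Specht n lam) :=
  Module.Basis.mk linearIndependent_polytabloid (by
    rw [linearIndependent_polytabloid.span_eq_top_of_card_eq_finrank']
    exact le_antisymm linearIndependent_polytabloid.fintype_card_le_finrank
      (finrank_specht_le hlam))

theorem spechtBasis_apply (hlam : lam.card = n) (T : SYT n lam) :
    spechtBasis hlam T = T.1.polytabloidSpecht :=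
  Module.Basis.mk_apply _ _ _

/-! ### The action of the 0-Hecke algebra on words -/

section WordOp

variable {ι : Type*} [DecidableEq ι]

/-- The action of `π̄` at the positions `x`, `y` on words: an ascent is an eigenvector for `-1`, a
plateau for `0`, and the two letters of a descent are exchanged. -/
def wordOp (x y : ι) : ((ι → ℕ) →₀ ℂ) →ₗ[ℂ] ((ι → ℕ) →₀ ℂ) :=
  Finsupp.linearCombination ℂ fun w => if w x < w y then -Finsupp.single w 1 else
    if w x = w y then 0 else Finsupp.single (w ∘ swap x y) 1

theorem wordOp_of_lt {x y : ι} {w : ι → ℕ} (h : w x < w y) :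
    wordOp x y (Finsupp.single w 1) = -Finsupp.single w 1 := by
  simp [wordOp, h]

theorem wordOp_of_eq {x y : ι} {w : ι → ℕ} (h : w x = w y) :
    wordOp x y (Finsupp.single w 1) = 0 := by
  simp [wordOp, h]

theorem wordOp_of_gt {x y : ι} {w : ι → ℕ} (h : w y < w x) :
    wordOp x y (Finsupp.single w 1) = Finsupp.single (w ∘ swap x y) 1 := by
  simp [wordOp, h.ne', h.not_gt]

theorem wordOp_ext {ι : Type*} {f g : ((ι → ℕ) →₀ ℂ) →ₗ[ℂ] ((ι → ℕ) →₀ ℂ)}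
    (h : ∀ w, f (Finsupp.single w 1) = g (Finsupp.single w 1)) : f = g := by
  refine Finsupp.lhom_ext' fun w => LinearMap.ext_ring (h w)

theorem wordOp_sq (x y : ι) : wordOp x y * wordOp x y = -wordOp x y := by
  refine wordOp_ext fun w => ?_
  rw [Module.End.mul_apply, LinearMap.neg_apply]
  rcases lt_trichotomy (w x) (w y) with h | h | h
  · rw [wordOp_of_lt h, map_neg, wordOp_of_lt h]
  · rw [wordOp_of_eq h, map_zero, neg_zero]
  · rw [wordOp_of_gt h, wordOp_of_lt (by simpa using h)]

theorem wordOp_comm {x y z t : ι} (h1 : x ≠ z) (h2 : x ≠ t) (h3 : y ≠ z) (h4 : y ≠ t) :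
    wordOp x y * wordOp z t = wordOp z t * wordOp x y := by
  refine wordOp_ext fun w => ?_
  rw [Module.End.mul_apply, Module.End.mul_apply]
  have a1 : swap x y z = z := swap_apply_of_ne_of_ne h1.symm h3.symm
  have a2 : swap x y t = t := swap_apply_of_ne_of_ne h2.symm h4.symm
  have a3 : swap z t x = x := swap_apply_of_ne_of_ne h1 h2
  have a4 : swap z t y = y := swap_apply_of_ne_of_ne h3 h4
  rcases lt_trichotomy (w x) (w y) with h | h | h <;>
    rcases lt_trichotomy (w z) (w t) with h' | h' | h'
  · rw [wordOp_of_lt h, wordOp_of_lt h', map_neg, map_neg, wordOp_of_lt h, wordOp_of_lt h']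
  · rw [wordOp_of_lt h, wordOp_of_eq h', map_neg, map_zero, wordOp_of_eq h', neg_zero]
  · rw [wordOp_of_lt h, wordOp_of_gt h', map_neg, wordOp_of_gt h', wordOp_of_lt
      (by simpa only [Function.comp_apply, a3, a4])]
  · rw [wordOp_of_eq h, wordOp_of_lt h', map_neg, map_zero, wordOp_of_eq h, neg_zero]
  · rw [wordOp_of_eq h, wordOp_of_eq h', map_zero, map_zero]
  · rw [wordOp_of_eq h, wordOp_of_gt h', map_zero, wordOp_of_eq
      (by simpa only [Function.comp_apply, a3, a4])]
  · rw [wordOp_of_gt h, wordOp_of_lt h', map_neg, wordOp_of_gt h, wordOp_of_lt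
      (by simpa only [Function.comp_apply, a1, a2])]
  · rw [wordOp_of_gt h, wordOp_of_eq h', map_zero, wordOp_of_eq
      (by simpa only [Function.comp_apply, a1, a2])]
  · rw [wordOp_of_gt h, wordOp_of_gt h',
      wordOp_of_gt (by simpa only [Function.comp_apply, a3, a4]),
      wordOp_of_gt
      (by simpa only [Function.comp_apply, a1, a2])]
    have h : swap x y * swap z t = swap z t * swap x y := by
      rw [mul_swap_eq_swap_mul, a1, a2]
    exact congrArg (fun f : Perm ι => Finsupp.single (w ∘ f) (1 : ℂ)) h.symm

theorem wordOp_braid {x y z : ι} (hxy : x ≠ y) (hyz : y ≠ z) (hxz : x ≠ z) :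
    wordOp x y * wordOp y z * wordOp x y = wordOp y z * wordOp x y * wordOp y z := by
  have a1 : swap x y z = z := swap_apply_of_ne_of_ne hxz.symm hyz.symm
  have a2 : swap y z x = x := swap_apply_of_ne_of_ne hxy hxz
  have a3 : ∀ w : ι → ℕ, ((w ∘ swap x y) ∘ swap y z) ∘ swap x y =
      ((w ∘ swap y z) ∘ swap x y) ∘ swap y z := by
    intro w
    have h : swap x y * swap y z * swap x y = swap y z * swap x y * swap y z := by
      rw [swap_mul_swap_mul_swap hxy hxz, swap_comm x y, swap_comm y z,
        swap_mul_swap_mul_swap hyz.symm hxz.symm, swap_comm]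
    exact congrArg (fun f : Perm ι => w ∘ f) h
  refine wordOp_ext fun w => ?_
  simp only [Module.End.mul_apply]
  rcases lt_trichotomy (w x) (w y) with h | h | h <;>
    rcases lt_trichotomy (w y) (w z) with h' | h' | h' <;>
    rcases lt_trichotomy (w x) (w z) with h'' | h'' | h'' <;>
    first
    | omega
    | simp [wordOp_of_lt, wordOp_of_eq, wordOp_of_gt, h, h', h'', a1, a2, a3]

end WordOp

/-! ### The deformed Specht module -/

/-- The universal property of the 0-Hecke algebra. -/
def HeckeZero.lift {A : Type*} [Ring A] [Algebra ℂ A] (f : Fin (n - 1) → A)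
    (hsq : ∀ i, f i * f i = -f i) (hcomm : ∀ i j, i.1 + 2 ≤ j.1 → f i * f j = f j * f i)
    (hbraid : ∀ i j, j.1 = i.1 + 1 → f i * f j * f i = f j * f i * f j) :
    HeckeZero n →ₐ[ℂ] A :=
  RingQuot.liftAlgHom ℂ ⟨FreeAlgebra.lift ℂ f, by
    intro x y h
    induction h with
    | sq i => simpa using hsq i
    | comm i j h => simpa using hcomm i j h
    | braid i j h => simpa using hbraid i j h⟩

theorem HeckeZero.lift_gen {A : Type*} [Ring A] [Algebra ℂ A] (f : Fin (n - 1) → A) (hsq) (hcomm)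
    (hbraid) (i : Fin (n - 1)) : HeckeZero.lift f hsq hcomm hbraid (HeckeZero.gen i) = f i := by
  unfold HeckeZero.lift HeckeZero.gen
  exact (RingQuot.liftAlgHom_mkAlgHom_apply _ _ _ _).trans (FreeAlgebra.lift_ι_apply _ _)

theorem HeckeZero.algHom_ext {A : Type*} [Ring A] [Algebra ℂ A] {f g : HeckeZero n →ₐ[ℂ] A}
    (h : ∀ i, f (HeckeZero.gen i) = g (HeckeZero.gen i)) : f = g :=
  RingQuot.ringQuot_ext' (s := HeckeRel n) ℂ f g (FreeAlgebra.hom_ext (funext h))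

/-- A subspace stable under the generators is stable under the 0-Hecke algebra. -/
theorem HeckeZero.map_mem {V : Type*} [AddCommGroup V] [Module ℂ V]
    (ρ : HeckeZero n →ₐ[ℂ] Module.End ℂ V) (W : Submodule ℂ V)
    (h : ∀ i, ∀ v ∈ W, ρ (HeckeZero.gen i) v ∈ W) (a : HeckeZero n) : ∀ v ∈ W, ρ a v ∈ W := by
  obtain ⟨x, rfl⟩ := RingQuot.mkAlgHom_surjective ℂ (HeckeRel n) a
  induction x using FreeAlgebra.induction with
  | grade0 c =>
    intro v hv
    rw [AlgHom.commutes]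
    have : ρ (algebraMap ℂ (RingQuot (HeckeRel n)) c) v = c • v := by
      have := AlgHom.commutes ρ c
      exact congrArg (fun f : Module.End ℂ V => f v) this
    exact this ▸ W.smul_mem c hv
  | grade1 i => exact h i
  | mul x y hx hy =>
    intro v hv
    have : ρ (RingQuot.mkAlgHom ℂ (HeckeRel n) (x * y)) v =
        ρ (RingQuot.mkAlgHom ℂ (HeckeRel n) x) (ρ (RingQuot.mkAlgHom ℂ (HeckeRel n) y) v) := by
      rw [map_mul]
      exact congrArg (fun f : Module.End ℂ V => f v) (map_mul ρ _ _)
    exact this ▸ hx _ (hy v hv)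
  | add x y hx hy =>
    intro v hv
    have : ρ (RingQuot.mkAlgHom ℂ (HeckeRel n) (x + y)) v =
        ρ (RingQuot.mkAlgHom ℂ (HeckeRel n) x) v + ρ (RingQuot.mkAlgHom ℂ (HeckeRel n) y) v := by
      rw [map_add]
      exact congrArg (fun f : Module.End ℂ V => f v) (map_add ρ _ _)
    exact this ▸ W.add_mem (hx v hv) (hy v hv)

/-- A column permutation acts on a polytabloid by its sign. -/
theorem spechtRep_of_mem_colStab {t : Tableau n lam} {τ : Perm (Fin n)} (hτ : τ ∈ t.colStab) :
    spechtRep n lam τ t.polytabloidSpecht = ((Perm.sign τ : ℤ) : ℂ) • t.polytabloidSpecht := by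
  classical
  refine Subtype.ext (Finsupp.ext fun x => ?_)
  change permRep n lam τ t.polytabloid x = ((Perm.sign τ : ℤ) : ℂ) * t.polytabloid x
  rw [permRep_polytabloid_apply, polytabloid_apply, Finset.mul_sum]
  refine Finset.sum_equiv (Equiv.mulLeft τ) (fun σ => ?_) fun σ _ => ?_
  · simp [mul_mem_cancel_left hτ]
  · rw [Equiv.coe_mulLeft, mul_smul, map_mul]
    split_ifs
    · have h : ((Perm.sign τ : ℤ) : ℂ) * (Perm.sign τ : ℤ) = 1 := by
        rw [← Int.cast_mul, ← Units.val_mul, Int.units_mul_self]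
        simp
      push_cast
      rw [← mul_assoc, h, one_mul]
    · simp

theorem spechtRep_swap_of_col_eq {t : Tableau n lam} {i : Fin (n - 1)}
    (h : t.col (lo i) = t.col (hi i)) :
    spechtRep n lam (simpleSwap i) t.polytabloidSpecht = -t.polytabloidSpecht := by
  rw [spechtRep_of_mem_colStab]
  · rw [simpleSwap, Perm.sign_swap (lo_lt_hi i).ne]
    simp
  · intro k
    simp only [simpleSwap, Equiv.swap_apply_def]
    split_ifs with h1 h2
    · rw [h1, h]
    · rw [h2, h]
    · rfl

section Basis

variable (hlam : lam.card = n)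

theorem spechtRep_swap_of_ne {T : SYT n lam} {i : Fin (n - 1)}
    (hr : T.1.row (lo i) ≠ T.1.row (hi i)) (hc : T.1.col (lo i) ≠ T.1.col (hi i)) :
    spechtRep n lam (simpleSwap i) (spechtBasis hlam T) = spechtBasis hlam (T.swap i hr hc) := by
  rw [spechtBasis_apply, spechtBasis_apply, spechtRep_polytabloidSpecht]
  rfl

theorem spechtRep_swap_of_col {T : SYT n lam} {i : Fin (n - 1)}
    (hc : T.1.col (lo i) = T.1.col (hi i)) :
    spechtRep n lam (simpleSwap i) (spechtBasis hlam T) = -spechtBasis hlam T := by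
  rw [spechtBasis_apply, spechtRep_swap_of_col_eq hc]

/-- The smallest standard tableau that occurs in `v` can be read off at the tabloids. -/
theorem coeffAt_eq_repr (v : Specht n lam) (S : SYT n lam)
    (h : ∀ U < S, (spechtBasis hlam).repr v U = 0) :
    coeffAt S.1.tabloid v = (spechtBasis hlam).repr v S := by
  conv_lhs => rw [← (spechtBasis hlam).sum_repr v]
  rw [map_sum, Finset.sum_eq_single S]
  · rw [map_smul, spechtBasis_apply, coeffAt_polytabloidSpecht, SYT.polytabloid_apply_self,
      smul_eq_mul, mul_one]
  · intro U _ hU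
    rw [map_smul, spechtBasis_apply, coeffAt_polytabloidSpecht]
    rcases lt_or_gt_of_ne hU with h1 | h1
    · rw [h U h1, zero_smul]
    · rw [SYT.polytabloid_apply_of_lt h1, smul_zero]
  · simp

theorem isTrailingTerm_of_coeffAt (v : Specht n lam) (T : SYT n lam)
    (h1 : coeffAt T.1.tabloid v = 1) (h0 : ∀ S < T, coeffAt S.1.tabloid v = 0) :
    IsTrailingTerm (spechtBasis hlam) SYT.Below v (spechtBasis hlam T) := by
  have hz : ∀ S, S < T → (spechtBasis hlam).repr v S = 0 := by
    intro S
    induction S using WellFoundedLT.induction with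
    | ind S ih =>
      intro hS
      rw [← coeffAt_eq_repr hlam v S fun U hU => ih U hU (hU.trans hS), h0 S hS]
  have hT : (spechtBasis hlam).repr v T = 1 := by rw [← coeffAt_eq_repr hlam v T hz, h1]
  refine ⟨T, by rw [hT]; exact one_ne_zero, fun U hU => ?_, by rw [hT, one_smul]⟩
  rw [SYT.below_iff_lt]
  rcases lt_trichotomy U T with h | h | h
  · exact absurd (hz U h) hU
  · exact Or.inl h
  · exact Or.inr h

/-- If `i` and `i + 1` lie in one row of `T`, then `e_T` is the trailing term of `s_i e_T`. -/
theorem isTrailingTerm_of_row_eq {T : SYT n lam} {i : Fin (n - 1)}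
    (hr : T.1.row (lo i) = T.1.row (hi i)) : IsTrailingTerm (spechtBasis hlam) SYT.Below
      (spechtRep n lam (simpleSwap i) (spechtBasis hlam T)) (spechtBasis hlam T) := by
  refine isTrailingTerm_of_coeffAt hlam _ T ?_ fun S hS => ?_
  · rw [spechtBasis_apply, coeffAt_spechtRep_polytabloidSpecht, SYT.permRep_swap_apply_self hr]
  · rw [spechtBasis_apply, coeffAt_spechtRep_polytabloidSpecht, SYT.permRep_swap_apply_of_lt hr hS]

/-- The operator `π̄_i` on the Specht module. -/
def spechtOp (i : Fin (n - 1)) : Module.End ℂ (Specht n lam) :=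
  (spechtBasis hlam).constr ℂ fun T =>
    if T.1.row (lo i) < T.1.row (hi i) then -spechtBasis hlam T else
      if T.1.row (lo i) = T.1.row (hi i) then 0 else
        spechtRep n lam (simpleSwap i) (spechtBasis hlam T)

theorem spechtOp_of_lt {i : Fin (n - 1)} {T : SYT n lam} (h : T.1.row (lo i) < T.1.row (hi i)) :
    spechtOp hlam i (spechtBasis hlam T) = -spechtBasis hlam T := by
  rw [spechtOp, Module.Basis.constr_basis, if_pos h]

theorem spechtOp_of_eq {i : Fin (n - 1)} {T : SYT n lam} (h : T.1.row (lo i) = T.1.row (hi i)) :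
    spechtOp hlam i (spechtBasis hlam T) = 0 := by
  rw [spechtOp, Module.Basis.constr_basis, if_neg h.not_lt, if_pos h]

theorem spechtOp_of_gt {i : Fin (n - 1)} {T : SYT n lam} (h : T.1.row (hi i) < T.1.row (lo i)) :
    spechtOp hlam i (spechtBasis hlam T) =
      spechtBasis hlam (T.swap i h.ne' (T.2.col_lt_of_row_le h.le).ne) := by
  rw [← spechtRep_swap_of_ne]
  rw [spechtOp, Module.Basis.constr_basis, if_neg h.not_gt, if_neg h.ne']

/-- The embedding of the Specht module into the span of words that sends `e_T` to the row word
of `T`. -/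
def toWords : Specht n lam →ₗ[ℂ] ((Fin n → ℕ) →₀ ℂ) :=
  (Finsupp.lmapDomain ℂ ℂ fun T : SYT n lam => T.1.row) ∘ₗ (spechtBasis hlam).repr.toLinearMap

theorem toWords_basis (T : SYT n lam) :
    toWords hlam (spechtBasis hlam T) = Finsupp.single T.1.row 1 := by
  simp [toWords]

theorem toWords_injective : Function.Injective (toWords hlam) :=
  (Finsupp.mapDomain_injective fun _ _ h => SYT.word_injective (congrArg toLex h)).comp
    (spechtBasis hlam).repr.injective

theorem toWords_spechtOp (i : Fin (n - 1)) (v : Specht n lam) :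
    toWords hlam (spechtOp hlam i v) = wordOp (lo i) (hi i) (toWords hlam v) := by
  refine LinearMap.congr_fun (f := toWords hlam ∘ₗ spechtOp hlam i)
    (g := wordOp (lo i) (hi i) ∘ₗ toWords hlam) ((spechtBasis hlam).ext fun T => ?_) v
  rw [LinearMap.comp_apply, LinearMap.comp_apply, toWords_basis]
  rcases lt_trichotomy (T.1.row (lo i)) (T.1.row (hi i)) with h | h | h
  · rw [spechtOp_of_lt hlam h, map_neg, toWords_basis, wordOp_of_lt h]
  · rw [spechtOp_of_eq hlam h, map_zero, wordOp_of_eq h]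
  · rw [spechtOp_of_gt hlam h, toWords_basis, wordOp_of_gt h]
    exact congrArg (fun f => Finsupp.single f (1 : ℂ)) (funext fun k => SYT.row_swap _ _ _ _ _)

/-- The deformed action of the 0-Hecke algebra on the Specht module.  The relations hold since
they hold for the action on words. -/
def spechtHecke : HeckeZero n →ₐ[ℂ] Module.End ℂ (Specht n lam) :=
  HeckeZero.lift (spechtOp hlam)
    (fun i => LinearMap.ext fun v => toWords_injective hlam (by
      have h := LinearMap.congr_fun (wordOp_sq (lo i) (hi i)) (toWords hlam v)
      simpa only [Module.End.mul_apply, LinearMap.neg_apply, map_neg, toWords_spechtOp] using h))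
    (fun i j hij => LinearMap.ext fun v => toWords_injective hlam (by
      have h := LinearMap.congr_fun (wordOp_comm (x := lo i) (y := hi i) (z := lo j) (t := hi j)
        (by simp only [lo, ne_eq, Fin.mk.injEq]; omega)
        (by simp only [lo, hi, ne_eq, Fin.mk.injEq]; omega)
        (by simp only [lo, hi, ne_eq, Fin.mk.injEq]; omega)
        (by simp only [hi, ne_eq, Fin.mk.injEq]; omega)) (toWords hlam v)
      simpa only [Module.End.mul_apply, toWords_spechtOp] using h))
    (fun i j hij => LinearMap.ext fun v => toWords_injective hlam (by
      have hmid : hi i = lo j := Fin.ext hij.symm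
      have h := LinearMap.congr_fun (wordOp_braid (x := lo i) (y := lo j) (z := hi j)
        (by simp only [lo, ne_eq, Fin.mk.injEq]; omega)
        (lo_lt_hi j).ne
        (by simp only [lo, hi, ne_eq, Fin.mk.injEq]; omega)) (toWords hlam v)
      simpa only [Module.End.mul_apply, toWords_spechtOp, hmid] using h))

theorem spechtHecke_gen (i : Fin (n - 1)) :
    spechtHecke hlam (HeckeZero.gen i) = spechtOp hlam i :=
  HeckeZero.lift_gen _ _ _ _ _

theorem isTrailingTerm_basis_iff {T U : SYT n lam} :
    IsTrailingTerm (spechtBasis hlam) SYT.Below (spechtBasis hlam U) (spechtBasis hlam T) ↔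
      U = T := by
  constructor
  · rintro ⟨j, hj, -, h⟩
    rw [Module.Basis.repr_self, Finsupp.single_apply] at hj h
    obtain rfl : U = j := by
      by_contra hne
      exact hj (if_neg hne)
    rw [if_pos rfl, one_smul] at h
    exact ((spechtBasis hlam).injective h).symm
  · rintro rfl
    refine ⟨U, by simp, fun k hk => Or.inl ?_, by simp⟩
    by_contra hne
    exact hk (by rw [Module.Basis.repr_self, Finsupp.single_apply, if_neg (Ne.symm hne)])

theorem basis_ne_neg {T U : SYT n lam} : spechtBasis hlam U ≠ -spechtBasis hlam T := by
  intro h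
  have h1 := congrArg (fun v => (spechtBasis hlam).repr v U) h
  simp only [map_neg, Module.Basis.repr_self, Finsupp.neg_apply, Finsupp.single_apply] at h1
  split_ifs at h1 <;> norm_num at h1

theorem not_isTrailingTerm_neg {T : SYT n lam} :
    ¬ IsTrailingTerm (spechtBasis hlam) SYT.Below (-spechtBasis hlam T) (spechtBasis hlam T) := by
  rintro ⟨j, hj, -, h⟩
  rw [map_neg, Module.Basis.repr_self, Finsupp.neg_apply, Finsupp.single_apply] at hj h
  obtain rfl : T = j := by
    by_contra hne
    exact hj (by rw [if_neg hne, neg_zero])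
  rw [if_pos rfl, neg_smul, one_smul] at h
  exact basis_ne_neg hlam h

theorem SYT.cases_swap (T : SYT n lam) (i : Fin (n - 1)) :
    T.1.row (lo i) = T.1.row (hi i) ∨
    (T.1.row (lo i) < T.1.row (hi i) ∧ T.1.col (lo i) = T.1.col (hi i)) ∨
    ∃ (hr : T.1.row (lo i) ≠ T.1.row (hi i)) (hc : T.1.col (lo i) ≠ T.1.col (hi i)),
      (T.1.row (lo i) < T.1.row (hi i) ∧ T < T.swap i hr hc) ∨
      (T.1.row (hi i) < T.1.row (lo i) ∧ T.swap i hr hc < T) := by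
  rcases lt_trichotomy (T.1.row (lo i)) (T.1.row (hi i)) with h | h | h
  · by_cases hc : T.1.col (lo i) = T.1.col (hi i)
    · exact Or.inr (Or.inl ⟨h, hc⟩)
    · exact Or.inr (Or.inr ⟨h.ne, hc, Or.inl ⟨h, SYT.lt_swap.2 h⟩⟩)
  · exact Or.inl h
  · exact Or.inr (Or.inr ⟨h.ne', (T.2.col_lt_of_row_le h.le).ne,
      Or.inr ⟨h, SYT.swap_lt.2 h.not_gt⟩⟩)

theorem isDeformation_spechtHecke : IsDeformation (spechtRep n lam) (spechtBasis hlam) SYT.Below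
    (spechtHecke hlam) := by
  simp only [SYT.below_eq]
  have htr := @isTrailingTerm_of_row_eq n lam hlam
  have hb := @isTrailingTerm_basis_iff n lam hlam
  have hn := @not_isTrailingTerm_neg n lam hlam
  simp only [SYT.below_eq] at htr hb hn
  -- in one row, `s_i e_T` is neither `-e_T` nor some other `e_U`
  have hrow : ∀ {i : Fin (n - 1)} {T : SYT n lam}, T.1.row (lo i) = T.1.row (hi i) →
      spechtRep n lam (simpleSwap i) (spechtBasis hlam T) ≠ -spechtBasis hlam T ∧
      ∀ U, spechtRep n lam (simpleSwap i) (spechtBasis hlam T) = spechtBasis hlam U → U = T := by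
    intro i T h
    refine ⟨fun h' => hn (h' ▸ htr h), fun U h' => hb.1 (h' ▸ htr h)⟩
  refine ⟨fun i T => ?_, fun i T h => ?_, fun i T h => ?_, fun i T U h hlt => ?_,
    fun i T U h hlt => ?_⟩
  · rcases T.cases_swap i with h | ⟨-, h⟩ | ⟨hr, hc, h⟩
    · exact Or.inl (htr h)
    · exact Or.inr (Or.inl (spechtRep_swap_of_col hlam h))
    · refine Or.inr (Or.inr ⟨_, spechtRep_swap_of_ne hlam hr hc, ?_⟩)
      exact h.imp And.right And.right
  · rw [spechtHecke_gen]
    rcases T.cases_swap i with h' | ⟨-, h'⟩ | ⟨hr, hc, h'⟩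
    · exact spechtOp_of_eq hlam h'
    · rw [spechtRep_swap_of_col hlam h'] at h
      exact absurd h hn
    · rw [spechtRep_swap_of_ne hlam hr hc] at h
      have h2 := hb.1 h
      rcases h' with h' | h'
      · exact absurd h2 h'.2.ne'
      · exact absurd h2 h'.2.ne
  · rw [spechtHecke_gen]
    rcases T.cases_swap i with h' | ⟨h', -⟩ | ⟨hr, hc, h'⟩
    · exact absurd h (hrow h').1
    · exact spechtOp_of_lt hlam h'
    · rw [spechtRep_swap_of_ne hlam hr hc] at h
      exact absurd h (basis_ne_neg hlam)
  · rw [spechtHecke_gen]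
    rcases T.cases_swap i with h' | ⟨h', -⟩ | ⟨hr, hc, h'⟩
    · exact absurd ((hrow h').2 U h) hlt.ne'
    · exact spechtOp_of_lt hlam h'
    · rw [spechtRep_swap_of_ne hlam hr hc] at h
      obtain rfl := (spechtBasis hlam).injective h
      rcases h' with h' | h'
      · exact spechtOp_of_lt hlam h'.1
      · exact absurd hlt h'.2.not_gt
  · rw [spechtHecke_gen]
    rcases T.cases_swap i with h' | ⟨-, h'⟩ | ⟨hr, hc, h'⟩
    · exact absurd ((hrow h').2 U h) hlt.ne
    · rw [spechtRep_swap_of_col hlam h'] at h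
      exact absurd h.symm (basis_ne_neg hlam)
    · rw [spechtRep_swap_of_ne hlam hr hc] at h
      obtain rfl := (spechtBasis hlam).injective h
      rcases h' with h' | h'
      · exact absurd hlt h'.2.not_gt
      · exact spechtOp_of_gt hlam h'.1

/-- The cases of a deformation are exhaustive and determine the action. -/
theorem IsDeformation.unique {ι V : Type*} [AddCommGroup V] [Module ℂ V]
    {R : Representation ℂ (Perm (Fin n)) V} {B : Module.Basis ι ℂ V} {lt : ι → ι → Prop}
    {ρ ρ' : HeckeZero n →ₐ[ℂ] Module.End ℂ V} (h : IsDeformation R B lt ρ)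
    (h' : IsDeformation R B lt ρ') : ρ' = ρ := by
  refine HeckeZero.algHom_ext fun i => B.ext fun t => ?_
  rcases h.exhaustive i t with h1 | h1 | ⟨u, h1, h2 | h2⟩
  · rw [h.of_trailing i t h1, h'.of_trailing i t h1]
  · rw [h.of_neg i t h1, h'.of_neg i t h1]
  · rw [h.of_gt i t u h1 h2, h'.of_gt i t u h1 h2]
  · rw [h.of_lt i t u h1 h2, h'.of_lt i t u h1 h2]

end Basis

/-! ### The quasisymmetric characteristic -/

section Series

variable (hlam : lam.card = n)

open Classical in
/-- The operators `π̄_i` are triangular in the basis of standard polytabloids, and the set of `i`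
with diagonal entry `-1` at `S` is `ides S`. -/
theorem repr_spechtOp (i : Fin (n - 1)) (v : Specht n lam) (S : SYT n lam)
    (h : ∀ U, S < U → (spechtBasis hlam).repr v U = 0) :
    (spechtBasis hlam).repr (spechtOp hlam i v) S =
      (if i ∈ S.ides then -1 else 0) * (spechtBasis hlam).repr v S := by
  conv_lhs => rw [← (spechtBasis hlam).sum_repr v]
  rw [map_sum, map_sum, Finsupp.finsetSum_apply, Finset.sum_eq_single S]
  · rw [map_smul, map_smul, Finsupp.smul_apply, smul_eq_mul, mul_comm]
    congr 1
    rcases S.cases_swap i with h' | ⟨h', -⟩ | ⟨hr, hc, ⟨h', -⟩ | ⟨h', h2⟩⟩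
    · rw [spechtOp_of_eq hlam h', if_neg (fun hi' => Nat.ne_of_lt hi' h' : i ∉ S.ides)]
      simp
    · rw [spechtOp_of_lt hlam h', if_pos (show i ∈ S.ides from h')]
      simp
    · rw [spechtOp_of_lt hlam h', if_pos (show i ∈ S.ides from h')]
      simp
    · rw [spechtOp_of_gt hlam h', if_neg (fun hi' => Nat.lt_asymm h' hi' : i ∉ S.ides),
        Module.Basis.repr_self, Finsupp.single_eq_of_ne h2.ne']
  · intro T _ hT
    rw [map_smul, map_smul, Finsupp.smul_apply, smul_eq_mul]
    rcases lt_or_gt_of_ne hT with hlt | hlt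
    · have h3 : (spechtBasis hlam).repr (spechtOp hlam i (spechtBasis hlam T)) S = 0 := by
        rcases T.cases_swap i with h' | ⟨h', -⟩ | ⟨hr, hc, ⟨h', -⟩ | ⟨h', h2⟩⟩
        · rw [spechtOp_of_eq hlam h']
          simp
        · rw [spechtOp_of_lt hlam h']
          simp [Finsupp.single_eq_of_ne hT.symm]
        · rw [spechtOp_of_lt hlam h']
          simp [Finsupp.single_eq_of_ne hT.symm]
        · rw [spechtOp_of_gt hlam h', Module.Basis.repr_self,
            Finsupp.single_eq_of_ne (h2.trans hlt).ne']
      rw [h3, mul_zero]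
    · rw [h T hlt, zero_mul]
  · simp

/-- The position of a standard tableau in the order `◁`. -/
def SYT.index (n : ℕ) (lam : YoungDiagram) : SYT n lam ≃o Fin (Fintype.card (SYT n lam)) :=
  (monoEquivOfFin (SYT n lam) rfl).symm

/-- The standard polytabloids as a basis of the deformed Specht module. -/
def heckeBasis : Module.Basis (SYT n lam) ℂ (HeckeModule (spechtHecke hlam)) := spechtBasis hlam

open Classical in
theorem repr_gen_smul (i : Fin (n - 1)) (v : HeckeModule (spechtHecke hlam)) (S : SYT n lam)
    (h : ∀ U, S < U → (heckeBasis hlam).repr v U = 0) :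
    (heckeBasis hlam).repr (HeckeZero.gen i • v) S =
      (if i ∈ S.ides then -1 else 0) * (heckeBasis hlam).repr v S := by
  refine Eq.trans ?_ (repr_spechtOp hlam i v S h)
  rw [← spechtHecke_gen]
  rfl

/-- The span of the `k` smallest standard polytabloids is an `H_n(0)`-submodule of the deformed
Specht module. -/
def heckeFlag (k : ℕ) : Submodule (HeckeZero n) (HeckeModule (spechtHecke hlam)) where
  carrier := {v | ∀ T, k ≤ (SYT.index n lam T : ℕ) → (heckeBasis hlam).repr v T = 0}
  add_mem' hv hw T hT := by rw [map_add, Finsupp.add_apply, hv T hT, hw T hT, add_zero]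
  zero_mem' T _ := by rw [map_zero, Finsupp.zero_apply]
  smul_mem' a v hv := HeckeZero.map_mem (V := HeckeModule (spechtHecke hlam)) (spechtHecke hlam)
    { carrier := {v | ∀ T, k ≤ (SYT.index n lam T : ℕ) → (heckeBasis hlam).repr v T = 0}
      add_mem' := fun hv hw T hT => by
        rw [map_add, Finsupp.add_apply, hv T hT, hw T hT, add_zero]
      zero_mem' := fun T _ => by rw [map_zero, Finsupp.zero_apply]
      smul_mem' := fun c v hv T hT => by rw [map_smul, Finsupp.smul_apply, hv T hT, smul_zero] }
    (fun i v hv S hS => (repr_gen_smul hlam i v S fun U hU =>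
      hv U (hS.trans (Fin.lt_def.1 ((SYT.index n lam).strictMono hU)).le)).trans
        (by rw [hv S hS, mul_zero])) a v hv

theorem mem_heckeFlag {k : ℕ} {v : HeckeModule (spechtHecke hlam)} : v ∈ heckeFlag hlam k ↔
    ∀ T, k ≤ (SYT.index n lam T : ℕ) → (heckeBasis hlam).repr v T = 0 := Iff.rfl

theorem heckeFlag_mono {k l : ℕ} (h : k ≤ l) : heckeFlag hlam k ≤ heckeFlag hlam l :=
  fun _ hv => (mem_heckeFlag hlam).2 fun T hT => (mem_heckeFlag hlam).1 hv T (h.trans hT)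

theorem mem_heckeFlag_of_succ {k : Fin (Fintype.card (SYT n lam))}
    {v : HeckeModule (spechtHecke hlam)} (hv : v ∈ heckeFlag hlam (k + 1)) :
    v ∈ heckeFlag hlam k ↔
      (heckeBasis hlam).repr v ((SYT.index n lam).symm k) = 0 := by
  rw [mem_heckeFlag] at hv ⊢
  refine ⟨fun h => h _ (by rw [OrderIso.apply_symm_apply]), fun h T hT => ?_⟩
  rcases hT.lt_or_eq with h1 | h1
  · exact hv T h1
  · rw [← h]
    congr 1
    rw [OrderIso.eq_symm_apply]
    exact Fin.ext h1.symm

theorem basis_mem_heckeFlag (k : Fin (Fintype.card (SYT n lam))) :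
    heckeBasis hlam ((SYT.index n lam).symm k) ∈
      heckeFlag hlam (k + 1) := by
  rw [mem_heckeFlag]
  intro T hT
  rw [Module.Basis.repr_self, Finsupp.single_eq_of_ne]
  rintro rfl
  rw [OrderIso.apply_symm_apply] at hT
  omega

theorem heckeFlag_covBy (k : Fin (Fintype.card (SYT n lam))) :
    heckeFlag hlam k ⋖ heckeFlag hlam (k + 1) := by
  refine ⟨lt_of_le_of_ne (heckeFlag_mono hlam (Nat.le_succ _)) fun h => ?_, fun C h1 h2 => ?_⟩
  · have h1 := basis_mem_heckeFlag hlam k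
    have h2 := (mem_heckeFlag_of_succ hlam h1).1 (h ▸ h1)
    simp at h2
  · obtain ⟨c, hcC, hc⟩ := SetLike.exists_of_lt h1
    have hx := mt (mem_heckeFlag_of_succ hlam (h2.le hcC)).2 hc
    refine not_le_of_gt h2 fun v hv => ?_
    set x := (heckeBasis hlam).repr c ((SYT.index n lam).symm k) with hxd
    set y := (heckeBasis hlam).repr v ((SYT.index n lam).symm k) with hyd
    have hcC' : (y / x) • c ∈ C := C.smul_of_tower_mem _ hcC
    have hdiff : v - (y / x) • c ∈ heckeFlag hlam k := by
      rw [mem_heckeFlag_of_succ hlam (sub_mem hv (h2.le hcC'))]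
      rw [map_sub, map_smul, Finsupp.sub_apply, Finsupp.smul_apply, ← hxd, ← hyd, smul_eq_mul,
        div_mul_cancel₀ _ hx, sub_self]
    simpa using add_mem (h1.le hdiff) hcC'

theorem factorIndex_heckeFlag (k : Fin (Fintype.card (SYT n lam))) :
    factorIndex (heckeFlag hlam k) (heckeFlag hlam (k + 1)) =
      ((SYT.index n lam).symm k).ides := by
  classical
  set S := (SYT.index n lam).symm k with hS
  have key : ∀ (i : Fin (n - 1)) (v : HeckeModule (spechtHecke hlam))
      (hv : v ∈ heckeFlag hlam (k + 1)), HeckeZero.gen i • v + v ∈ heckeFlag hlam k ↔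
        ((if i ∈ S.ides then -1 else 0) + 1) *
          (heckeBasis hlam).repr v S = 0 := by
    intro i v hv
    rw [mem_heckeFlag_of_succ hlam (add_mem (Submodule.smul_mem _ _ hv) hv), map_add,
      Finsupp.add_apply, repr_gen_smul, add_mul, one_mul]
    intro U hU
    refine (mem_heckeFlag hlam).1 hv U ?_
    have := Fin.lt_def.1 ((SYT.index n lam).strictMono hU)
    rw [OrderIso.apply_symm_apply] at this
    exact this
  have hq : ∀ (i : Fin (n - 1)) (x : heckeFlag hlam (k + 1)),
      (HeckeZero.gen i • (Submodule.Quotient.mk x : (heckeFlag hlam (k + 1)) ⧸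
        (heckeFlag hlam k).submoduleOf (heckeFlag hlam (k + 1))) = -Submodule.Quotient.mk x) ↔
      HeckeZero.gen i • (x : HeckeModule (spechtHecke hlam)) + x ∈ heckeFlag hlam k := by
    intro i x
    rw [← Submodule.Quotient.mk_smul, ← Submodule.Quotient.mk_neg, Submodule.Quotient.eq,
      sub_neg_eq_add]
    rfl
  ext i
  constructor
  · intro h
    have h1 := (hq i ⟨_, basis_mem_heckeFlag hlam k⟩).1 (h _)
    rw [key i _ (basis_mem_heckeFlag hlam k)] at h1
    by_contra hi'
    rw [if_neg hi', zero_add, one_mul, ← hS, Module.Basis.repr_self, Finsupp.single_eq_same] at h1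
    exact one_ne_zero h1
  · intro hi' q
    obtain ⟨x, rfl⟩ := Submodule.Quotient.mk_surjective _ q
    rw [hq, key i x x.2, if_pos hi']
    simp

/-- The composition series of the deformed Specht module given by the flag. -/
def heckeSeries : CompositionSeries (Submodule (HeckeZero n) (HeckeModule (spechtHecke hlam))) where
  length := Fintype.card (SYT n lam)
  toFun k := heckeFlag hlam k
  step k := heckeFlag_covBy hlam k

theorem frobQChar_spechtHecke (N : ℕ) :
    frobQChar N n (HeckeModule (spechtHecke hlam)) = ∑ T : SYT n lam, fundamental N n T.ides := by
  have hs := (exists_series (n := n) (HeckeModule (spechtHecke hlam))).choose_spec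
  have h0 : (heckeSeries hlam).head = ⊥ := by
    rw [eq_bot_iff]
    intro v hv
    have : (heckeBasis hlam).repr v = 0 :=
      Finsupp.ext fun T => (mem_heckeFlag hlam).1 hv T (Nat.zero_le _)
    exact (LinearEquiv.map_eq_zero_iff _).1 this
  have h1 : (heckeSeries hlam).last = ⊤ := by
    rw [eq_top_iff]
    intro v _
    refine (mem_heckeFlag hlam).2 fun T hT => ?_
    exact absurd (SYT.index n lam T).2 (not_lt.2 hT)
  rw [frobQChar, seriesChar_eq N _ (heckeSeries hlam) (hs.1.trans h0.symm) (hs.2.trans h1.symm)]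
  refine Fintype.sum_equiv (SYT.index n lam).symm.toEquiv _ _ fun k => ?_
  exact congrArg (fundamental N n) (factorIndex_heckeFlag hlam k)

end Series

/-! ### Standardization -/

/-- The letter of a tableau in a given cell. -/
def Tableau.letter (t : Tableau n lam) (c : {c : ℕ × ℕ // c ∈ lam.cells}) : Fin n :=
  Equiv.symm (α := Fin n) t c

theorem Tableau.pos_letter (t : Tableau n lam) (c : {c : ℕ × ℕ // c ∈ lam.cells}) :
    t.pos (t.letter c) = c.1 :=
  congrArg Subtype.val (Equiv.apply_symm_apply (α := Fin n) t c)

theorem Tableau.row_letter (t : Tableau n lam) (c : {c : ℕ × ℕ // c ∈ lam.cells}) :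
    t.row (t.letter c) = c.1.1 := congrArg Prod.fst (t.pos_letter c)

theorem Tableau.col_letter (t : Tableau n lam) (c : {c : ℕ × ℕ // c ∈ lam.cells}) :
    t.col (t.letter c) = c.1.2 := congrArg Prod.snd (t.pos_letter c)

theorem Tableau.letter_pos (t : Tableau n lam) (k : Fin n) :
    t.letter ⟨t.pos k, t.pos_mem k⟩ = k :=
  t.pos_injective (t.pos_letter _)

/-- The words `f` that contribute to `F_{ides T}`. -/
def SYT.Compatible {N : ℕ} (T : SYT n lam) (f : Fin n → Fin N) : Prop :=
  Monotone f ∧ ∀ j ∈ T.ides, f (lo j) < f (hi j)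

/-- Along a plateau of `f` the letters of `T` move weakly down. -/
theorem SYT.Compatible.row_le {N : ℕ} {T : SYT n lam} {f : Fin n → Fin N} (h : T.Compatible f)
    {a b : Fin n} (hab : a ≤ b) (hf : f a = f b) : T.1.row b ≤ T.1.row a := by
  have hmono : Monotone f := h.1
  have key : ∀ m : ℕ, a.1 ≤ m → ∀ hm : m < n, m ≤ b.1 → T.1.row ⟨m, hm⟩ ≤ T.1.row a := by
    intro m hm
    induction m, hm using Nat.le_induction with
    | base => intro _ _; exact le_rfl
    | succ m ham ih =>
      intro hm hmb
      refine le_trans ?_ (ih (by omega) (by omega))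
      have h1 : ¬ f (lo ⟨m, by omega⟩) < f (hi ⟨m, by omega⟩) := by
        rw [not_lt]
        refine (hmono (b := b) (Fin.le_def.2 hmb)).trans ?_
        exact hf.symm.trans_le (hmono (Fin.le_def.2 ham))
      exact not_lt.1 fun h2 => h1 (h.2 ⟨m, by omega⟩ h2)
  exact key b.1 (Fin.le_def.1 hab) b.2 le_rfl

/-- The semistandard tableau obtained from `T` by replacing each letter `k` by `f k`. -/
def SYT.fill {N : ℕ} (T : SYT n lam) (f : Fin n → Fin N) (h : T.Compatible f) : SSYT N lam :=
  ⟨{  entry := fun i j => if hc : (i, j) ∈ lam.cells then f (T.1.letter ⟨(i, j), hc⟩) else 0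
      row_weak' := by
        intro i j1 j2 hj hc
        have hc1 : (i, j1) ∈ lam := lam.up_left_mem le_rfl hj.le hc
        rw [dif_pos ((YoungDiagram.mem_cells _).2 hc1), dif_pos ((YoungDiagram.mem_cells _).2 hc)]
        refine Fin.le_def.1 (h.1 (T.2.le ?_ ?_))
        · rw [Tableau.row_letter, Tableau.row_letter]
        · rw [Tableau.col_letter, Tableau.col_letter]
          exact hj.le
      col_strict' := by
        intro i1 i2 j hi' hc
        have hc1 : (i1, j) ∈ lam := lam.up_left_mem hi'.le le_rfl hc
        rw [dif_pos ((YoungDiagram.mem_cells _).2 hc1), dif_pos ((YoungDiagram.mem_cells _).2 hc)]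
        have hle : T.1.letter ⟨(i1, j), hc1⟩ ≤ T.1.letter ⟨(i2, j), hc⟩ := by
          refine T.2.le ?_ ?_
          · rw [Tableau.row_letter, Tableau.row_letter]
            exact hi'.le
          · rw [Tableau.col_letter, Tableau.col_letter]
        refine Fin.lt_def.1 (lt_of_le_of_ne (h.1 hle) fun heq => ?_)
        have h1 := h.row_le hle heq
        rw [Tableau.row_letter, Tableau.row_letter] at h1
        exact absurd h1 (not_le.2 hi')
      zeros' := fun hc => dif_neg hc }, by
    intro i j hc
    exact (dif_pos ((YoungDiagram.mem_cells _).2 hc)).trans_lt (Fin.is_lt _)⟩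

theorem SYT.fill_apply {N : ℕ} (T : SYT n lam) (f : Fin n → Fin N) (h : T.Compatible f)
    (c : {c : ℕ × ℕ // c ∈ lam.cells}) : (T.fill f h).1 c.1.1 c.1.2 = f (T.1.letter c) :=
  dif_pos c.2

theorem SYT.fill_pos {N : ℕ} (T : SYT n lam) (f : Fin n → Fin N) (h : T.Compatible f)
    (k : Fin n) : (T.fill f h).1 (T.1.row k) (T.1.col k) = f k := by
  refine (T.fill_apply f h ⟨T.1.pos k, T.1.pos_mem k⟩).trans ?_
  rw [Tableau.letter_pos]

/-- The key by which standardization sorts the cells: first by entry, then by column. -/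
def cellKey (S : SemistandardYoungTableau lam) (c : ℕ × ℕ) : ℕ ×ₗ ℕ := toLex (S c.1 c.2, c.2)

theorem cellKey_injOn (S : SemistandardYoungTableau lam) {c d : ℕ × ℕ} (hc : c ∈ lam) (hd : d ∈ lam)
    (h : cellKey S c = cellKey S d) : c = d := by
  have h1 : S c.1 c.2 = S d.1 d.2 := congrArg (fun x => (ofLex x).1) h
  have h2 : c.2 = d.2 := congrArg (fun x => (ofLex x).2) h
  refine Prod.ext ?_ h2
  rcases lt_trichotomy c.1 d.1 with h3 | h3 | h3
  · have := S.col_strict h3 hd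
    rw [← h2] at this h1
    omega
  · exact h3
  · have := S.col_strict h3 hc
    rw [← h2] at h1
    omega

theorem SYT.strictMono_cellKey {N : ℕ} (T : SYT n lam) (f : Fin n → Fin N) (h : T.Compatible f) :
    StrictMono fun k => cellKey (T.fill f h).1 (T.1.pos k) := by
  intro a b hab
  change toLex ((T.fill f h).1 (T.1.row a) (T.1.col a), T.1.col a) <
    toLex ((T.fill f h).1 (T.1.row b) (T.1.col b), T.1.col b)
  rw [SYT.fill_pos, SYT.fill_pos, Prod.Lex.toLex_lt_toLex]
  rcases (h.1 hab.le).lt_or_eq with h1 | h1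
  · exact Or.inl h1
  · refine Or.inr ⟨by rw [h1], ?_⟩
    by_contra hcon
    exact absurd (T.2.le (h.row_le hab.le h1) (not_lt.1 hcon)) (not_le.2 hab)

theorem SYT.fill_injective {N : ℕ} {T T' : SYT n lam} {f f' : Fin n → Fin N} (h : T.Compatible f)
    (h' : T'.Compatible f') (heq : T.fill f h = T'.fill f' h') : T = T' ∧ f = f' := by
  have hrange : ∀ (S : SemistandardYoungTableau lam) (t : Tableau n lam),
      Set.range (fun k => cellKey S (t.pos k)) = cellKey S '' {c | c ∈ lam} := by
    intro S t
    ext x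
    constructor
    · rintro ⟨k, rfl⟩
      exact ⟨_, t.pos_mem k, rfl⟩
    · rintro ⟨c, hc, rfl⟩
      obtain ⟨k, hk⟩ := t.exists_pos hc
      exact ⟨k, congrArg (cellKey S) hk⟩
  have h1 := T.strictMono_cellKey f h
  have h2 := T'.strictMono_cellKey f' h'
  rw [← heq] at h2
  have h3 := (StrictMono.range_inj h1 h2).1 ((hrange _ _).trans (hrange _ _).symm)
  have hT : T = T' := Subtype.ext (Tableau.ext_pos fun k =>
    cellKey_injOn _ (T.1.pos_mem k) (T'.1.pos_mem k) (congrFun h3 k))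
  refine ⟨hT, funext fun k => Fin.ext ?_⟩
  rw [← T.fill_pos f h k, ← T'.fill_pos f' h' k, heq, hT]

theorem SYT.fill_surjective (hlam : lam.card = n) {N : ℕ} (S : SSYT N lam) :
    ∃ (T : SYT n lam) (f : Fin n → Fin N) (h : T.Compatible f), T.fill f h = S := by
  classical
  set K : Finset (ℕ ×ₗ ℕ) := lam.cells.image (cellKey S.1) with hK
  have hcard : K.card = n := by
    rw [hK, Finset.card_image_of_injOn fun c hc d hd h => cellKey_injOn S.1 hc hd h]
    exact hlam
  have hbij : Function.Bijective (fun c : {c : ℕ × ℕ // c ∈ lam.cells} =>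
      (⟨cellKey S.1 c.1, Finset.mem_image_of_mem _ c.2⟩ : K)) := by
    constructor
    · intro c d h
      exact Subtype.ext (cellKey_injOn S.1 c.2 d.2 (congrArg Subtype.val h))
    · rintro ⟨x, hx⟩
      obtain ⟨c, hc, rfl⟩ := Finset.mem_image.1 hx
      exact ⟨⟨c, hc⟩, rfl⟩
  let t : Tableau n lam := (K.orderIsoOfFin hcard).toEquiv.trans (Equiv.ofBijective _ hbij).symm
  have hkey : ∀ k, cellKey S.1 (t.pos k) = (K.orderIsoOfFin hcard k).1 := fun k =>
    congrArg Subtype.val ((Equiv.ofBijective _ hbij).apply_symm_apply (K.orderIsoOfFin hcard k))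
  have hlt : ∀ {a b}, cellKey S.1 (t.pos a) < cellKey S.1 (t.pos b) ↔ a < b := by
    intro a b
    rw [hkey, hkey]
    exact (K.orderIsoOfFin hcard).lt_iff_lt
  have hlt' : ∀ {a b}, a < b ↔ S.1 (t.row a) (t.col a) < S.1 (t.row b) (t.col b) ∨
      S.1 (t.row a) (t.col a) = S.1 (t.row b) (t.col b) ∧ t.col a < t.col b := by
    intro a b
    rw [← hlt]
    exact Prod.Lex.toLex_lt_toLex
  have ht : t.IsStandard := by
    constructor
    · intro a b h1 h2
      have h3 := S.1.row_weak h2 (t.pos_mem b)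
      rw [hlt', h1]
      rcases h3.lt_or_eq with h4 | h4
      · exact Or.inl h4
      · exact Or.inr ⟨h4, h2⟩
    · intro a b h1 h2
      have h3 := S.1.col_strict h2 (t.pos_mem b)
      rw [hlt', h1]
      exact Or.inl h3
  have hcomp : SYT.Compatible (⟨t, ht⟩ : SYT n lam)
      (fun k => (⟨S.1 (t.row k) (t.col k), S.2 _ _ (t.pos_mem k)⟩ : Fin N)) := by
    constructor
    · intro a b hab
      rcases hab.lt_or_eq with h | h
      · rcases hlt'.1 h with h1 | h1
        · exact Fin.le_def.2 h1.le
        · exact Fin.le_def.2 h1.1.le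
      · rw [h]
    · intro i (hr : t.row (lo i) < t.row (hi i))
      rcases hlt'.1 (lo_lt_hi i) with h1 | h1
      · exact Fin.lt_def.2 h1
      · have h2 := S.1.row_weak h1.2 (lam.up_left_mem hr.le le_rfl (t.pos_mem (hi i)))
        have h3 := S.1.col_strict hr (t.pos_mem (hi i))
        exact absurd h1.1 (h2.trans_lt h3).ne
  refine ⟨⟨t, ht⟩, _, hcomp, Subtype.ext (SemistandardYoungTableau.ext fun i j => ?_)⟩
  by_cases hc : (i, j) ∈ lam.cells
  · obtain ⟨k, hk⟩ := t.exists_pos hc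
    obtain rfl : t.row k = i := congrArg Prod.fst hk
    obtain rfl : t.col k = j := congrArg Prod.snd hk
    exact SYT.fill_pos ⟨t, ht⟩ _ hcomp k
  · rw [SemistandardYoungTableau.zeros _ hc, SemistandardYoungTableau.zeros _ hc]

theorem sum_fundamental_eq_schur (hlam : lam.card = n) (N : ℕ) :
    ∑ T : SYT n lam, fundamental N n T.ides = schur N lam := by
  classical
  unfold fundamental schur
  rw [Finset.sum_sigma']
  have hmem : ∀ p : (_ : SYT n lam) × (Fin n → Fin N), p ∈ (Finset.univ.sigma fun T : SYT n lam =>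
      (Finset.univ : Finset (Fin n → Fin N)).filter
        (fun f => Monotone f ∧ ∀ j ∈ T.ides, f (lo j) < f (hi j))) → p.1.Compatible p.2 := by
    rintro ⟨T, f⟩ hp
    exact (Finset.mem_filter.1 (Finset.mem_sigma.1 hp).2).2
  refine Finset.sum_bij (fun p hp => p.1.fill p.2 (hmem p hp)) ?_ ?_ ?_ ?_
  · intro _ _
    exact Finset.mem_univ _
  · rintro ⟨T, f⟩ hp ⟨T', f'⟩ hp' h
    obtain ⟨rfl, rfl⟩ := SYT.fill_injective (hmem _ hp) (hmem _ hp') h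
    rfl
  · intro S _
    obtain ⟨T, f, h, rfl⟩ := SYT.fill_surjective hlam S
    exact ⟨⟨T, f⟩, Finset.mem_sigma.2 ⟨Finset.mem_univ _, Finset.mem_filter.2
      ⟨Finset.mem_univ _, h⟩⟩, rfl⟩
  · rintro ⟨T, f⟩ hp
    refine Fintype.prod_equiv (T.1 : Fin n ≃ {c : ℕ × ℕ // c ∈ lam.cells}) _ _ fun k => ?_
    exact congrArg X (Fin.ext (T.fill_pos f (hmem _ hp) k).symm)

/-! ### Invariants of Young subgroups in the Specht module -/

/-- A permutation that respects a strict order pulled back from `ℤ` is trivial. -/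
theorem eq_one_of_strictMono {ι : Type*} [Finite ι] {G : ι → ℤ} (hG : Function.Injective G)
    {σ : Perm ι} (h : ∀ a b, G a < G b → G (σ a) < G (σ b)) : σ = 1 := by
  classical
  have := Fintype.ofFinite ι
  by_contra hne
  obtain ⟨a, ha⟩ : ∃ a, σ a ≠ a := by
    by_contra hcon
    push Not at hcon
    exact hne (Equiv.ext hcon)
  obtain ⟨k, hk, hmin⟩ := Finset.exists_min_image (Finset.univ.filter fun a => σ a ≠ a) G
    ⟨a, by simpa using ha⟩
  have hk' : σ k ≠ k := (Finset.mem_filter.1 hk).2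
  have hmin' : ∀ b, G b < G k → σ b = b := by
    intro b hb
    by_contra hcon
    exact not_le.2 hb (hmin b (by simpa using hcon))
  rcases lt_trichotomy (G (σ k)) (G k) with h1 | h1 | h1
  · exact hk' (σ.injective (hmin' _ h1))
  · exact hk' (hG h1)
  · have h2 : σ (σ⁻¹ k) = k := σ.apply_symm_apply k
    rcases lt_trichotomy (G (σ⁻¹ k)) (G k) with h3 | h3 | h3
    · have h4 := hmin' _ h3
      rw [h2] at h4
      rw [← h4] at h3
      exact lt_irrefl _ h3
    · rw [hG h3] at h2
      exact hk' h2
    · have h4 := h _ _ h3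
      rw [h2] at h4
      exact lt_asymm h1 h4

/-- The statistic `∑ g(k) row(k)` of a standard tableau strictly decreases under column
permutations if `g` strictly increases along the columns.  After adding a large multiple of the
column index to both `g` and the row index, this is the rearrangement inequality for all letters
at once. -/
theorem Tableau.IsStandard.sum_mul_row_lt {t : Tableau n lam} (ht : t.IsStandard) {g : Fin n → ℕ}
    (hg : ∀ a b, t.col a = t.col b → a < b → g a < g b) {σ : Perm (Fin n)} (hσ : σ ∈ t.colStab)
    (h1 : σ ≠ 1) : ∑ k, (g (σ k) : ℤ) * t.row k < ∑ k, (g k : ℤ) * t.row k := by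
  set M : ℤ := ∑ k, ((g k : ℤ) + t.row k) + 1 with hM
  have hMk : ∀ k, (g k : ℤ) + t.row k < M := fun k =>
    Int.lt_add_one_of_le (Finset.single_le_sum (f := fun k => (g k : ℤ) + t.row k)
      (fun _ _ => by positivity) (Finset.mem_univ k))
  have hM0 : 0 < M := Int.lt_add_one_of_le (Finset.sum_nonneg fun _ _ => by positivity)
  set F : Fin n → ℤ := fun k => g k + M * t.col k with hF
  set G : Fin n → ℤ := fun k => t.row k + M * t.col k with hG
  have hcol : ∀ a b, t.col a < t.col b → M * t.col a + M ≤ M * t.col b := by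
    intro a b h
    have h' : (t.col a : ℤ) + 1 ≤ t.col b := by exact_mod_cast h
    nlinarith
  have hGF : ∀ a b, G a < G b → F a < F b := by
    intro a b hab
    have ha := hMk a
    have hb := hMk b
    simp only [hF, hG] at hab ⊢
    rcases lt_trichotomy (t.col a) (t.col b) with h | h | h
    · have := hcol a b h
      omega
    · rw [h] at hab ⊢
      have hr : t.row a < t.row b := by omega
      have := hg a b h (ht.2 a b h hr)
      omega
    · have := hcol b a h
      omega
  have hGinj : Function.Injective G := by
    intro a b hab
    have ha := hMk a
    have hb := hMk b
    simp only [hG] at hab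
    rcases lt_trichotomy (t.col a) (t.col b) with h | h | h
    · have := hcol a b h
      omega
    · rw [h] at hab
      exact t.eq_of_row_col (by omega) h
    · have := hcol b a h
      omega
  have hmono : Monovary F G := fun a b h => (hGF a b h).le
  have hlt : ∑ k, F (σ k) * G k < ∑ k, F k * G k := by
    refine (hmono.sum_comp_perm_mul_lt_sum_mul_iff (σ := σ)).2 fun hmv => h1 ?_
    refine eq_one_of_strictMono hGinj fun a b hab => ?_
    by_contra hcon
    rcases (not_lt.1 hcon).lt_or_eq with h2 | h2
    · exact not_lt.2 (hmv hab) (hGF _ _ h2)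
    · rw [σ.injective (hGinj h2)] at hab
      exact lt_irrefl _ hab
  have hexp : ∀ τ : Perm (Fin n), τ ∈ t.colStab → ∑ k, F (τ k) * G k =
      ∑ k, (g (τ k) : ℤ) * t.row k + (M * ∑ k, (g k : ℤ) * t.col k +
        ∑ k, M * t.col k * G k) := by
    intro τ hτ
    have h2 : ∑ k, (g (τ k) : ℤ) * t.col k = ∑ k, (g k : ℤ) * t.col k := by
      rw [← Equiv.sum_comp τ fun k => (g k : ℤ) * t.col k]
      exact Finset.sum_congr rfl fun k _ => by rw [hτ k]
    rw [← h2, Finset.mul_sum, ← Finset.sum_add_distrib, ← Finset.sum_add_distrib]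
    refine Finset.sum_congr rfl fun k _ => ?_
    simp only [hF, hG, hτ k]
    ring
  rw [hexp σ hσ, show ∑ k, F k * G k = _ from hexp 1 (one_mem _)] at hlt
  exact lt_of_add_lt_add_right hlt

/-- The group of permutations that preserve the level sets of `g`. -/
def stab {α : Type*} (g : Fin n → α) : Subgroup (Perm (Fin n)) where
  carrier := {σ | ∀ k, g (σ k) = g k}
  one_mem' _ := rfl
  mul_mem' {σ τ} hσ hτ k := (hσ (τ k)).trans (hτ k)
  inv_mem' {σ} hσ k := by simpa using (hσ (σ⁻¹ k)).symm

theorem mem_stab {α : Type*} {g : Fin n → α} {σ : Perm (Fin n)} :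
    σ ∈ stab g ↔ ∀ k, g (σ k) = g k := Iff.rfl

section Average

variable {V : Type*} [AddCommGroup V] [Module ℂ V] (R : Representation ℂ (Perm (Fin n)) V)

open Classical in
/-- The sum of the elements of a subgroup, acting on a representation. -/
def subgroupSum (H : Subgroup (Perm (Fin n))) : V →ₗ[ℂ] V :=
  ∑ σ ∈ Finset.univ.filter (· ∈ H), R σ

/-- The invariants of a subgroup. -/
def fixedBy (H : Subgroup (Perm (Fin n))) : Submodule ℂ V where
  carrier := {v | ∀ σ ∈ H, R σ v = v}
  add_mem' hv hw σ hσ := by rw [map_add, hv σ hσ, hw σ hσ]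
  zero_mem' σ _ := map_zero _
  smul_mem' c v hv σ hσ := by rw [map_smul, hv σ hσ]

variable {R} {H : Subgroup (Perm (Fin n))}

theorem subgroupSum_apply_of_mem {σ : Perm (Fin n)} (hσ : σ ∈ H) (v : V) :
    subgroupSum R H (R σ v) = subgroupSum R H v := by
  classical
  simp only [subgroupSum, LinearMap.sum_apply]
  refine Finset.sum_equiv (Equiv.mulRight σ) (fun τ => ?_) fun τ _ => ?_
  · simp [mul_mem_cancel_right hσ]
  · simp [map_mul]

theorem subgroupSum_mem_fixedBy (v : V) : subgroupSum R H v ∈ fixedBy R H := by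
  classical
  intro σ hσ
  simp only [subgroupSum, LinearMap.sum_apply, map_sum]
  refine Finset.sum_equiv (Equiv.mulLeft σ) (fun τ => ?_) fun τ _ => ?_
  · simp [mul_mem_cancel_left hσ]
  · simp [map_mul]

theorem subgroupSum_of_mem_fixedBy {v : V} (hv : v ∈ fixedBy R H) :
    subgroupSum R H v = (Nat.card H : ℂ) • v := by
  classical
  simp only [subgroupSum, LinearMap.sum_apply]
  rw [Finset.sum_congr rfl fun σ hσ => hv σ (Finset.mem_filter.1 hσ).2, Finset.sum_const,
    Nat.card_eq_fintype_card, Fintype.card_subtype, Nat.cast_smul_eq_nsmul]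

theorem card_subgroup_ne_zero : (Nat.card H : ℂ) ≠ 0 := Nat.cast_ne_zero.2 Nat.card_pos.ne'

theorem range_subgroupSum : LinearMap.range (subgroupSum R H) = fixedBy R H := by
  apply le_antisymm
  · rintro _ ⟨v, rfl⟩
    exact subgroupSum_mem_fixedBy v
  · intro v hv
    refine ⟨(Nat.card H : ℂ)⁻¹ • v, ?_⟩
    rw [map_smul, subgroupSum_of_mem_fixedBy hv, inv_smul_smul₀ card_subgroup_ne_zero]

open Classical in
/-- The average of the character over a subgroup is the dimension of the invariants. -/
theorem sum_trace_eq [Module.Finite ℂ V] :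
    ∑ σ ∈ Finset.univ.filter (· ∈ H), LinearMap.trace ℂ V (R σ) =
      Nat.card H * Module.finrank ℂ (fixedBy R H) := by
  have hproj : LinearMap.IsProj (fixedBy R H) ((Nat.card H : ℂ)⁻¹ • subgroupSum R H) := by
    constructor
    · intro v
      exact (fixedBy R H).smul_mem _ (subgroupSum_mem_fixedBy v)
    · intro v hv
      rw [LinearMap.smul_apply, subgroupSum_of_mem_fixedBy hv,
        inv_smul_smul₀ card_subgroup_ne_zero]
  have h := hproj.trace
  rw [map_smul, smul_eq_mul, subgroupSum, map_sum] at h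
  rw [← h, mul_inv_cancel_left₀ card_subgroup_ne_zero]

end Average

theorem SYT.Compatible.lt_of_col {N : ℕ} {T : SYT n lam} {g : Fin n → Fin N} (h : T.Compatible g)
    {a b : Fin n} (hc : T.1.col a = T.1.col b) (hab : a < b) : g a < g b := by
  refine lt_of_le_of_ne (h.1 hab.le) fun heq => ?_
  exact absurd (T.2.le (h.row_le hab.le heq) hc.ge) (not_le.2 hab)

/-- A compatible standard tableau is determined by its rows up to permutations of the plateaus:
its rows are sorted decreasingly on each plateau. -/
theorem SYT.Compatible.eq_of_row {N : ℕ} {S T : SYT n lam} {g : Fin n → Fin N}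
    (hS : S.Compatible g) (hT : T.Compatible g) {σ : Perm (Fin n)} (hσ : σ ∈ stab g)
    (h : ∀ k, S.1.row k = T.1.row (σ k)) : S = T := by
  have hmono : ∀ {U : SYT n lam}, U.Compatible g →
      Monotone fun k => toLex (g k, OrderDual.toDual (U.1.row k)) := by
    intro U hU a b hab
    rw [Prod.Lex.toLex_le_toLex]
    rcases (hU.1 hab).lt_or_eq with h1 | h1
    · exact Or.inl h1
    · exact Or.inr ⟨h1, OrderDual.toDual_le_toDual.2 (hU.row_le hab h1)⟩
  have h1 := Tuple.unique_monotone (f := fun k => toLex (g k, OrderDual.toDual (T.1.row k)))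
    (σ := 1) (τ := σ) (hmono hT) (by
      have : (fun k => toLex (g k, OrderDual.toDual (T.1.row k))) ∘ σ =
          fun k => toLex (g k, OrderDual.toDual (S.1.row k)) := by
        funext k
        simp only [Function.comp_apply]
        rw [hσ k, h k]
      rw [this]
      exact hmono hS)
  refine SYT.word_injective (congrArg toLex (funext fun k => ?_))
  have h2 := congrArg (fun x => OrderDual.ofDual (ofLex x).2) (congrFun h1 k)
  rw [h k]
  exact h2.symm

open Classical in
theorem coeffAt_subgroupSum (H : Subgroup (Perm (Fin n))) (t : Tableau n lam)
    (x : Tabloid n lam) : coeffAt x (subgroupSum (spechtRep n lam) H t.polytabloidSpecht) =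
      ∑ σ ∈ Finset.univ.filter (· ∈ H), ∑ τ ∈ Finset.univ.filter (· ∈ t.colStab),
        if (σ • τ • t).tabloid = x then ((Perm.sign τ : ℤ) : ℂ) else 0 := by
  simp only [subgroupSum, LinearMap.sum_apply, map_sum]
  refine Finset.sum_congr rfl fun σ _ => ?_
  rw [coeffAt_spechtRep_polytabloidSpecht, permRep_polytabloid_apply]

/-- The statistic `∑ g(k) row(k)`. -/
def rowStat {N : ℕ} (g : Fin n → Fin N) (t : Tableau n lam) : ℤ :=
  ∑ k, ((g k : ℕ) : ℤ) * t.row k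

theorem rowStat_smul {N : ℕ} (g : Fin n → Fin N) (t : Tableau n lam) {σ : Perm (Fin n)}
    (hσ : σ ∈ stab g) (τ : Perm (Fin n)) :
    rowStat g (σ • τ • t) = ∑ k, ((g (τ k) : ℕ) : ℤ) * t.row k := by
  unfold rowStat
  rw [← Equiv.sum_comp (σ * τ)]
  refine Finset.sum_congr rfl fun k _ => ?_
  rw [smul_smul, Tableau.row_smul,
    show (σ * τ)⁻¹ ((σ * τ) k) = k from Equiv.symm_apply_apply _ _, Perm.mul_apply, hσ]

theorem rowStat_congr {N : ℕ} (g : Fin n → Fin N) {s t : Tableau n lam}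
    (h : s.tabloid = t.tabloid) : rowStat g s = rowStat g t :=
  Finset.sum_congr rfl fun k _ => by rw [Tableau.tabloid_eq_iff.1 h k]

/-- The tabloids of `σ e_T`, with `σ` in the Young subgroup, other than `{σ T}` have a smaller
statistic than `T`. -/
theorem SYT.Compatible.rowStat_lt {N : ℕ} {T : SYT n lam} {g : Fin n → Fin N}
    (hT : T.Compatible g) {s : Tableau n lam} {σ τ : Perm (Fin n)} (hσ : σ ∈ stab g)
    (hτ : τ ∈ T.1.colStab) (h1 : τ ≠ 1) (h : (σ • τ • T.1).tabloid = s.tabloid) :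
    rowStat g s < rowStat g T.1 := by
  rw [← rowStat_congr g h, rowStat_smul g T.1 hσ]
  exact T.2.sum_mul_row_lt (g := fun k => g k) (fun a b hc hab => hT.lt_of_col hc hab) hτ h1

theorem linearIndependent_subgroupSum {N : ℕ} (g : Fin n → Fin N) :
    LinearIndependent ℂ fun T : {T : SYT n lam // T.Compatible g} =>
      subgroupSum (spechtRep n lam) (stab g) T.1.1.polytabloidSpecht := by
  classical
  refine linearIndependent_of_triangular _ (fun T => coeffAt T.1.1.tabloid)
    (fun T => -rowStat g T.1.1) ?_ ?_
  · rintro ⟨T, hT⟩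
    rw [coeffAt_subgroupSum]
    have h : ∀ σ ∈ Finset.univ.filter (· ∈ stab g),
        (∑ τ ∈ Finset.univ.filter (· ∈ T.1.colStab),
          if (σ • τ • T.1).tabloid = T.1.tabloid then ((Perm.sign τ : ℤ) : ℂ) else 0) =
        if (σ • T.1).tabloid = T.1.tabloid then 1 else 0 := by
      intro σ hσ
      rw [Finset.sum_eq_single 1]
      · simp
      · intro τ hτ h1
        refine if_neg fun h => ?_
        exact lt_irrefl _ (hT.rowStat_lt (Finset.mem_filter.1 hσ).2 (Finset.mem_filter.1 hτ).2 h1 h)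
      · intro h
        exact absurd (Finset.mem_filter.2 ⟨Finset.mem_univ _, one_mem _⟩) h
    rw [Finset.sum_congr rfl h, Finset.sum_boole, Nat.cast_ne_zero]
    refine (Finset.card_pos.2 ⟨1, ?_⟩).ne'
    simp [one_mem]
  · rintro ⟨S, hS⟩ ⟨T, hT⟩ h
    rw [coeffAt_subgroupSum] at h
    obtain ⟨σ, hσ, h⟩ := Finset.exists_ne_zero_of_sum_ne_zero h
    obtain ⟨τ, hτ, h⟩ := Finset.exists_ne_zero_of_sum_ne_zero h
    have heq : (σ • τ • T.1).tabloid = S.1.tabloid := by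
      by_contra hcon
      exact h (if_neg hcon)
    replace hσ := (Finset.mem_filter.1 hσ).2
    rcases eq_or_ne τ 1 with rfl | h1
    · refine Or.inl (Subtype.ext (hS.eq_of_row hT (inv_mem hσ) fun k => ?_).symm)
      rw [one_smul] at heq
      exact (Tableau.tabloid_eq_iff.1 heq k).symm
    · exact Or.inr (neg_lt_neg (hT.rowStat_lt hσ (Finset.mem_filter.1 hτ).2 h1 heq))

/-- The averages of the compatible standard polytabloids span the averages of all of them: a
descent `i` of `T` on a plateau of `g` either kills the average or moves `T` up. -/
theorem subgroupSum_mem_span {N : ℕ} {g : Fin n → Fin N} (hg : Monotone g) (hlam : lam.card = n)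
    (T : SYT n lam) : subgroupSum (spechtRep n lam) (stab g) T.1.polytabloidSpecht ∈
      Submodule.span ℂ (Set.range fun T : {T : SYT n lam // T.Compatible g} =>
        subgroupSum (spechtRep n lam) (stab g) T.1.1.polytabloidSpecht) := by
  induction T using WellFoundedGT.induction with
  | ind T ih =>
    by_cases hT : T.Compatible g
    · exact Submodule.subset_span ⟨⟨T, hT⟩, rfl⟩
    · obtain ⟨i, hi', hlt⟩ : ∃ i ∈ T.ides, ¬ g (lo i) < g (hi i) := by
        by_contra hcon
        push Not at hcon
        exact hT ⟨hg, hcon⟩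
      have heq : g (lo i) = g (hi i) := le_antisymm (hg (lo_lt_hi i).le) (not_lt.1 hlt)
      have hmem : simpleSwap i ∈ stab g := by
        intro k
        simp only [simpleSwap, Equiv.swap_apply_def]
        split_ifs with h1 h2
        · rw [h1, heq]
        · rw [h2, heq]
        · rfl
      rw [← spechtBasis_apply hlam, ← subgroupSum_apply_of_mem hmem]
      by_cases hc : T.1.col (lo i) = T.1.col (hi i)
      · have h0 := subgroupSum_apply_of_mem (R := spechtRep n lam) hmem (spechtBasis hlam T)
        rw [spechtRep_swap_of_col hlam hc, map_neg] at h0 ⊢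
        have h2 : (2 : ℂ) • subgroupSum (spechtRep n lam) (stab g) (spechtBasis hlam T) = 0 := by
          rw [two_smul]
          nth_rewrite 1 [← h0]
          exact neg_add_cancel _
        rw [(smul_eq_zero_iff_right two_ne_zero).1 h2, neg_zero]
        exact Submodule.zero_mem _
      · have hr : T.1.row (lo i) ≠ T.1.row (hi i) := (show _ < _ from hi').ne
        rw [spechtRep_swap_of_ne hlam hr hc, spechtBasis_apply]
        exact ih _ (SYT.lt_swap.2 hi')

/-- The dimension of the invariants of a Young subgroup in the Specht module. -/
theorem finrank_fixedBy_stab {N : ℕ} {g : Fin n → Fin N} (hg : Monotone g) (hlam : lam.card = n) :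
    Module.finrank ℂ (fixedBy (spechtRep n lam) (stab g)) =
      Nat.card {T : SYT n lam // T.Compatible g} := by
  classical
  have hspan : fixedBy (spechtRep n lam) (stab g) =
      Submodule.span ℂ (Set.range fun T : {T : SYT n lam // T.Compatible g} =>
        subgroupSum (spechtRep n lam) (stab g) T.1.1.polytabloidSpecht) := by
    rw [← range_subgroupSum]
    apply le_antisymm
    · rintro _ ⟨v, rfl⟩
      rw [← (spechtBasis hlam).sum_repr v, map_sum]
      refine Submodule.sum_mem _ fun T _ => ?_
      rw [map_smul, spechtBasis_apply]
      exact Submodule.smul_mem _ _ (subgroupSum_mem_span hg hlam T)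
    · rw [Submodule.span_le]
      rintro _ ⟨T, rfl⟩
      exact ⟨_, rfl⟩
  rw [hspan, finrank_span_eq_card (linearIndependent_subgroupSum g), Nat.card_eq_fintype_card]

/-! ### The Frobenius characteristic through invariants of Young subgroups -/

/-- The monomials of the words that are constant on the fibres of a map add up to a product of
power sums in the sizes of the fibres. -/
theorem prod_psum_card_fiber {ι Q : Type*} [Fintype ι] [DecidableEq ι] [Fintype Q] [DecidableEq Q]
    (κ : ι → Q) (N : ℕ) :
    ∏ q, psum (Fin N) ℂ (Finset.univ.filter fun k => κ k = q).card =
      ∑ h : Q → Fin N, ∏ k, X (h (κ k)) := by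
  simp only [psum]
  rw [Fintype.prod_sum]
  refine Finset.sum_congr rfl fun h _ => ?_
  rw [← Finset.prod_fiberwise' Finset.univ κ fun q => (X (h q) : MvPolynomial (Fin N) ℂ)]
  refine Finset.prod_congr rfl fun q _ => ?_
  rw [Finset.prod_const]

section CycleClass

variable (σ : Perm (Fin n))

/-- The set of cycles of `σ`, fixed points included. -/
abbrev Cycles : Type := {c // c ∈ σ.cycleFactorsFinset} ⊕ {k : Fin n // σ k = k}

/-- The cycle that contains a given letter. -/
def cycleClass (k : Fin n) : Cycles σ :=
  if h : σ k = k then Sum.inr ⟨k, h⟩ else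
    Sum.inl ⟨σ.cycleOf k, Perm.cycleOf_mem_cycleFactorsFinset_iff.2 (Perm.mem_support.2 h)⟩

theorem cycleClass_eq_inr {k : Fin n} (x : {k : Fin n // σ k = k}) :
    cycleClass σ k = Sum.inr x ↔ k = x := by
  unfold cycleClass
  split_ifs with h
  · rw [Sum.inr.injEq, Subtype.ext_iff]
  · simp only [false_iff]
    rintro rfl
    exact h x.2

theorem cycleClass_eq_inl {k : Fin n} (c : {c // c ∈ σ.cycleFactorsFinset}) :
    cycleClass σ k = Sum.inl c ↔ k ∈ c.1.support := by
  unfold cycleClass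
  split_ifs with h
  · simp only [false_iff]
    intro hk
    exact Perm.mem_support.1 (Perm.mem_cycleFactorsFinset_support_le c.2 hk) h
  · rw [Sum.inl.injEq, Subtype.ext_iff]
    constructor
    · intro hc
      rw [← hc, Perm.mem_support_cycleOf_iff]
      exact ⟨Perm.SameCycle.refl _ _, Perm.mem_support.2 h⟩
    · intro hk
      exact (Perm.cycle_is_cycleOf hk c.2).symm

theorem sameCycle_of_cycleClass_eq {k l : Fin n} (h : cycleClass σ k = cycleClass σ l) :
    σ.SameCycle k l := by
  rcases hl : cycleClass σ l with c | x
  · rw [hl, cycleClass_eq_inl] at h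
    rw [cycleClass_eq_inl] at hl
    have h1 := Perm.cycle_is_cycleOf h c.2
    rw [h1, Perm.mem_support_cycleOf_iff] at hl
    exact hl.1
  · rw [hl, cycleClass_eq_inr] at h
    rw [cycleClass_eq_inr] at hl
    rw [h, hl]

theorem cycleClass_apply (k : Fin n) : cycleClass σ (σ k) = cycleClass σ k := by
  rcases h : cycleClass σ k with c | x
  · rw [cycleClass_eq_inl] at h ⊢
    have hc := (Perm.mem_cycleFactorsFinset_iff.1 c.2).2 k h
    rw [← hc, Perm.apply_mem_support]
    exact h
  · rw [cycleClass_eq_inr] at h ⊢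
    rw [h, x.2]

theorem cycleClass_surjective : Function.Surjective (cycleClass σ) := by
  rintro (c | x)
  · obtain ⟨k, hk⟩ := (Perm.mem_cycleFactorsFinset_iff.1 c.2).1.nonempty_support
    exact ⟨k, (cycleClass_eq_inl σ c).2 hk⟩
  · exact ⟨x, (cycleClass_eq_inr σ x).2 rfl⟩

open Classical in
/-- The power sum of the cycle type of `σ` is the generating function of the words fixed
by `σ`. -/
theorem prod_psum_partition (N : ℕ) : (σ.partition.parts.map (psum (Fin N) ℂ)).prod =
    ∑ f ∈ (Finset.univ : Finset (Fin n → Fin N)).filter (fun f => σ ∈ stab f),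
      ∏ k, (X (f k) : MvPolynomial (Fin N) ℂ) := by
  have h1 : (σ.partition.parts.map (psum (Fin N) ℂ)).prod =
      ∏ q, psum (Fin N) ℂ (Finset.univ.filter fun k => cycleClass σ k = q).card := by
    have hinl : ∀ c : {c // c ∈ σ.cycleFactorsFinset},
        (Finset.univ.filter fun k => cycleClass σ k = Sum.inl c).card = c.1.support.card := by
      intro c
      congr 1
      ext k
      simp [cycleClass_eq_inl]
    have hinr : ∀ x : {k : Fin n // σ k = k},
        (Finset.univ.filter fun k => cycleClass σ k = Sum.inr x).card = 1 := by
      intro x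
      rw [Finset.card_eq_one]
      refine ⟨x, ?_⟩
      ext k
      simp [cycleClass_eq_inr]
    have hfix : Fintype.card {k : Fin n // σ k = k} = Fintype.card (Fin n) - σ.support.card := by
      rw [← Finset.card_compl, Fintype.card_subtype]
      congr 1
      ext k
      simp
    rw [Fintype.prod_sum_type]
    simp only [hinl, hinr]
    rw [Finset.prod_const, Finset.card_univ, hfix, Perm.parts_partition, Multiset.map_add,
      Multiset.prod_add, Multiset.map_replicate, Multiset.prod_replicate, Perm.cycleType_def,
      Multiset.map_map, Finset.univ_eq_attach,
      Finset.prod_attach _ fun c : Perm (Fin n) => psum (Fin N) ℂ c.support.card]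
    rfl
  rw [h1, prod_psum_card_fiber]
  refine Finset.sum_bij (fun h _ k => h (cycleClass σ k)) ?_ ?_ ?_ ?_
  · intro h _
    refine Finset.mem_filter.2 ⟨Finset.mem_univ _, fun k => congrArg h ?_⟩
    exact cycleClass_apply σ k
  · intro h _ h' _ heq
    refine funext fun q => ?_
    obtain ⟨k, rfl⟩ := cycleClass_surjective σ q
    exact congrFun heq k
  · intro f hf
    have hf' : ∀ k, f (σ k) = f k := (Finset.mem_filter.1 hf).2
    refine ⟨fun q => f (cycleClass_surjective σ q).choose, Finset.mem_univ _, funext fun k => ?_⟩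
    obtain ⟨i, hi'⟩ := sameCycle_of_cycleClass_eq σ
      (cycleClass_surjective σ (cycleClass σ k)).choose_spec
    have hmem : σ ^ i ∈ stab f := zpow_mem (show σ ∈ stab f from hf') i
    exact (hmem _).symm.trans (congrArg f hi')
  · intro h _
    rfl

end CycleClass

/-- The cycle type of a permutation as a partition of `n`. -/
def cyclePartition (σ : Perm (Fin n)) : n.Partition where
  parts := σ.partition.parts
  parts_pos := σ.partition.parts_pos
  parts_sum := σ.partition.parts_sum.trans (Fintype.card_fin n)

theorem cyclePartition_eq_iff {σ τ : Perm (Fin n)} :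
    cyclePartition σ = cyclePartition τ ↔ IsConj σ τ := by
  rw [Perm.partition_eq_of_isConj, Nat.Partition.ext_iff, Nat.Partition.ext_iff]
  rfl

theorem cyclePartition_cycleRep (μ : n.Partition) : cyclePartition (cycleRep μ) = μ :=
  Nat.Partition.ext (exists_perm_partition μ).choose_spec

theorem zee_cyclePartition (σ : Perm (Fin n)) : zee (cyclePartition σ) =
    (n - σ.cycleType.sum).factorial * σ.cycleType.prod *
      ∏ i ∈ σ.cycleType.toFinset, (σ.cycleType.count i).factorial := by
  have hp : (cyclePartition σ).parts =
      σ.cycleType + Multiset.replicate (n - σ.cycleType.sum) 1 := by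
    change σ.partition.parts = _
    rw [Perm.parts_partition, Fintype.card_fin, Perm.sum_cycleType]
  have h1 : 1 ∉ σ.cycleType.toFinset := fun h =>
    absurd (Perm.two_le_of_mem_cycleType (Multiset.mem_toFinset.1 h)) (by norm_num)
  rw [zee, Finset.prod_mul_distrib, ← Finset.prod_multiset_count, hp]
  have h2 : ∏ i ∈ (σ.cycleType + Multiset.replicate (n - σ.cycleType.sum) 1).toFinset,
      ((σ.cycleType + Multiset.replicate (n - σ.cycleType.sum) 1).count i).factorial =
      ∏ i ∈ insert 1 σ.cycleType.toFinset,
        ((σ.cycleType + Multiset.replicate (n - σ.cycleType.sum) 1).count i).factorial := by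
    refine Finset.prod_subset (fun i hi' => ?_) fun i _ hi' => ?_
    · rw [Multiset.mem_toFinset, Multiset.mem_add] at hi'
      rw [Finset.mem_insert, Multiset.mem_toFinset]
      exact hi'.symm.imp_left Multiset.eq_of_mem_replicate
    · rw [Multiset.mem_toFinset] at hi'
      rw [Multiset.count_eq_zero_of_notMem hi', Nat.factorial_zero]
  have h3 : ∀ i ∈ σ.cycleType.toFinset,
      ((σ.cycleType + Multiset.replicate (n - σ.cycleType.sum) 1).count i).factorial =
        (σ.cycleType.count i).factorial := by
    intro i hi'
    rw [Multiset.count_add, Multiset.count_replicate, if_neg, add_zero]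
    rintro rfl
    exact h1 hi'
  rw [h2, Finset.prod_insert h1, Finset.prod_congr rfl h3, Multiset.prod_add,
    Multiset.prod_replicate, one_pow, mul_one, Multiset.count_add, Multiset.count_replicate_self,
    Multiset.count_eq_zero_of_notMem (fun h => h1 (Multiset.mem_toFinset.2 h)), zero_add]
  ring

theorem card_cyclePartition_mul_zee (μ : n.Partition) :
    (Finset.univ.filter fun σ : Perm (Fin n) => cyclePartition σ = μ).card * zee μ =
      n.factorial := by
  classical
  have h := Perm.card_isConj_mul_eq (cycleRep μ)
  rw [Fintype.card_fin, ← zee_cyclePartition, cyclePartition_cycleRep] at h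
  rw [← h, Nat.card_eq_fintype_card, Fintype.card_ofFinset]
  congr 2
  ext σ
  rw [Finset.mem_filter, and_iff_right (Finset.mem_univ _)]
  simp only [Finset.mem_filter, Finset.mem_univ, true_and]
  change _ ↔ IsConj (cycleRep μ) σ
  rw [isConj_comm, ← cyclePartition_eq_iff, cyclePartition_cycleRep]

section Frobenius

variable {V : Type*} [AddCommGroup V] [Module ℂ V] (R : Representation ℂ (Perm (Fin n)) V)

theorem trace_eq_of_isConj {σ τ : Perm (Fin n)} (h : IsConj σ τ) :
    LinearMap.trace ℂ V (R σ) = LinearMap.trace ℂ V (R τ) := by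
  obtain ⟨c, rfl⟩ := isConj_iff.1 h
  rw [map_mul, LinearMap.trace_mul_comm, ← map_mul, inv_mul_cancel_left]

/-- The Frobenius characteristic as an average over the symmetric group. -/
theorem factorial_smul_frobChar (N : ℕ) : (n.factorial : ℂ) • frobChar N R =
    ∑ σ, LinearMap.trace ℂ V (R σ) • (σ.partition.parts.map (psum (Fin N) ℂ)).prod := by
  rw [← Finset.sum_fiberwise Finset.univ (cyclePartition (n := n)), frobChar, Finset.smul_sum]
  refine Finset.sum_congr rfl fun μ _ => ?_
  have h : ∀ σ ∈ Finset.univ.filter fun σ : Perm (Fin n) => cyclePartition σ = μ,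
      LinearMap.trace ℂ V (R σ) • (σ.partition.parts.map (psum (Fin N) ℂ)).prod =
        LinearMap.trace ℂ V (R (cycleRep μ)) • psumPart (Fin N) ℂ μ := by
    intro σ hσ
    have hσ' : cyclePartition σ = μ := (Finset.mem_filter.1 hσ).2
    rw [trace_eq_of_isConj R (cyclePartition_eq_iff.1
      (hσ'.trans (cyclePartition_cycleRep μ).symm)), psumPart, ← hσ']
    rfl
  have hz : (zee μ : ℂ) ≠ 0 := by
    have h1 := card_cyclePartition_mul_zee μ
    have : zee μ ≠ 0 := fun h0 => n.factorial_ne_zero (by rw [← h1, h0, mul_zero])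
    exact_mod_cast this
  rw [Finset.sum_congr rfl h, Finset.sum_const, ← Nat.cast_smul_eq_nsmul ℂ, smul_smul,
    ← card_cyclePartition_mul_zee μ, ← smul_eq_C_mul, smul_smul]
  congr 1
  push_cast
  field_simp

open Classical in
/-- The number of rearrangements that sort `f` is the order of its stabilizer. -/
theorem card_filter_monotone {N : ℕ} (f : Fin n → Fin N) :
    (Finset.univ.filter fun τ : Perm (Fin n) => Monotone (f ∘ τ)).card = Nat.card (stab f) := by
  rw [Nat.card_eq_fintype_card, Fintype.card_subtype]
  refine Finset.card_equiv (Equiv.mulRight (Tuple.sort f)⁻¹) fun τ => ?_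
  simp only [Finset.mem_filter, Finset.mem_univ, true_and, Equiv.coe_mulRight, mem_stab]
  rw [← Tuple.comp_sort_eq_comp_iff_monotone]
  constructor
  · intro h k
    have h2 : Tuple.sort f ((Tuple.sort f)⁻¹ k) = k := Equiv.apply_symm_apply _ _
    have h3 := congrFun h ((Tuple.sort f)⁻¹ k)
    simp only [Function.comp_apply, h2] at h3
    exact h3
  · intro h
    funext k
    have h2 : (Tuple.sort f)⁻¹ (Tuple.sort f k) = k := Equiv.symm_apply_apply _ _
    have h3 := h (Tuple.sort f k)
    rw [Perm.mul_apply, h2] at h3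
    exact h3

theorem finrank_fixedBy_comp {N : ℕ} (f : Fin n → Fin N) (τ : Perm (Fin n)) :
    Module.finrank ℂ (fixedBy R (stab (f ∘ τ))) = Module.finrank ℂ (fixedBy R (stab f)) := by
  have hinv : ∀ v, R τ (R τ⁻¹ v) = v := fun v => by
    rw [← Module.End.mul_apply, ← map_mul, mul_inv_cancel, map_one, Module.End.one_apply]
  have hinv' : ∀ v, R τ⁻¹ (R τ v) = v := fun v => by
    rw [← Module.End.mul_apply, ← map_mul, inv_mul_cancel, map_one, Module.End.one_apply]
  have hinj : Function.Injective (R τ) := Function.LeftInverse.injective hinv'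
  have heq : (fixedBy R (stab (f ∘ τ))).map (R τ) = fixedBy R (stab f) := by
    ext v
    constructor
    · rintro ⟨w, hw, rfl⟩ σ hσ
      have h1 : τ⁻¹ * σ * τ ∈ stab (f ∘ τ) := by
        intro k
        have h2 : τ ((τ⁻¹ * σ * τ) k) = σ (τ k) := Equiv.apply_symm_apply _ _
        rw [Function.comp_apply, Function.comp_apply, h2, hσ]
      have h3 := hw _ h1
      rw [map_mul, map_mul, Module.End.mul_apply, Module.End.mul_apply] at h3
      have h4 := congrArg (R τ) h3
      rwa [hinv] at h4
    · intro hv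
      refine ⟨R τ⁻¹ v, fun σ hσ => ?_, hinv v⟩
      have h1 : τ * σ * τ⁻¹ ∈ stab f := by
        intro k
        have h2 := hσ (τ⁻¹ k)
        have h3 : τ (τ⁻¹ k) = k := Equiv.apply_symm_apply _ _
        rw [Function.comp_apply, Function.comp_apply, h3] at h2
        exact h2
      have h3 := hv _ h1
      rw [map_mul, map_mul, Module.End.mul_apply, Module.End.mul_apply] at h3
      have h4 := congrArg (R τ⁻¹) h3
      rwa [hinv'] at h4
  rw [← heq]
  exact (Submodule.equivMapOfInjective (R τ) hinj _).finrank_eq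

open Classical in
/-- The coefficients of the Frobenius characteristic are the dimensions of the invariants of the
Young subgroups. -/
theorem frobChar_eq_sum_monotone [Module.Finite ℂ V] (N : ℕ) : frobChar N R =
    ∑ g ∈ (Finset.univ : Finset (Fin n → Fin N)).filter Monotone,
      (Module.finrank ℂ (fixedBy R (stab g)) : ℂ) • ∏ k, X (g k) := by
  set m : (Fin n → Fin N) → MvPolynomial (Fin N) ℂ := fun f => ∏ k, X (f k) with hm
  set d : (Fin n → Fin N) → ℂ := fun f => Module.finrank ℂ (fixedBy R (stab f)) with hd
  have hmτ : ∀ f (τ : Perm (Fin n)), m (f ∘ τ) = m f := fun f τ =>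
    Equiv.prod_comp τ fun k => (X (f k) : MvPolynomial (Fin N) ℂ)
  have hdτ : ∀ f (τ : Perm (Fin n)), d (f ∘ τ) = d f := fun f τ => by
    simp only [hd, finrank_fixedBy_comp]
  -- group by words, each with the permutations that fix it
  have h1 : (n.factorial : ℂ) • frobChar N R = ∑ f, (Nat.card (stab f) * d f) • m f := by
    rw [factorial_smul_frobChar]
    simp only [prod_psum_partition, Finset.smul_sum, Finset.sum_filter]
    rw [Finset.sum_comm]
    refine Finset.sum_congr rfl fun f _ => ?_
    rw [hd, ← sum_trace_eq (R := R) (H := stab f), Finset.sum_smul, Finset.sum_filter]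
    refine Finset.sum_congr rfl fun σ _ => ?_
    rw [smul_ite, smul_zero]
  -- sort each word in all possible ways
  have h2 : ∑ f, (Nat.card (stab f) * d f) • m f =
      (n.factorial : ℂ) • ∑ g ∈ (Finset.univ : Finset (Fin n → Fin N)).filter Monotone,
        d g • m g := by
    have h3 : ∀ f, (Nat.card (stab f) * d f) • m f =
        ∑ τ : Perm (Fin n), if Monotone (f ∘ τ) then d f • m f else 0 := by
      intro f
      rw [← Finset.sum_filter, Finset.sum_const, card_filter_monotone, mul_smul,
        Nat.cast_smul_eq_nsmul]
    rw [Finset.sum_congr rfl fun f _ => h3 f, Finset.sum_comm]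
    have h4 : ∀ τ : Perm (Fin n), (∑ f, if Monotone (f ∘ τ) then d f • m f else 0) =
        ∑ g ∈ (Finset.univ : Finset (Fin n → Fin N)).filter Monotone, d g • m g := by
      intro τ
      rw [Finset.sum_filter]
      refine Fintype.sum_equiv (Equiv.arrowCongr τ.symm (Equiv.refl (Fin N))) _ _ fun f => ?_
      have : (Equiv.arrowCongr τ.symm (Equiv.refl (Fin N))) f = f ∘ τ := rfl
      rw [this, hdτ, hmτ]
    rw [Finset.sum_congr rfl fun τ _ => h4 τ, Finset.sum_const, Finset.card_univ,
      Fintype.card_perm, Fintype.card_fin, Nat.cast_smul_eq_nsmul]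
  have h0 : (n.factorial : ℂ) ≠ 0 := Nat.cast_ne_zero.2 n.factorial_ne_zero
  exact smul_right_injective _ h0 (h1.trans h2)

end Frobenius

theorem sum_fundamental_eq_frobChar (hlam : lam.card = n) (N : ℕ) :
    ∑ T : SYT n lam, fundamental N n T.ides = frobChar N (spechtRep n lam) := by
  classical
  rw [frobChar_eq_sum_monotone]
  unfold fundamental
  simp only [Finset.sum_filter]
  rw [Finset.sum_comm]
  refine Finset.sum_congr rfl fun g _ => ?_
  split_ifs with hg
  · rw [finrank_fixedBy_stab hg hlam, Nat.card_eq_fintype_card, Fintype.card_subtype,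
      ← Finset.sum_filter, Finset.sum_const, Nat.cast_smul_eq_nsmul]
    congr 2
    ext T
    rw [Finset.mem_filter, Finset.mem_filter]
    rfl
  · exact Finset.sum_eq_zero fun T _ => if_neg fun h => hg h.1

end ZeroHecke

end

theorem mainTheorem2 (n : ℕ) (lam : YoungDiagram) (hlam : lam.card = n) :
    IsStrictTotalOrder (ZeroHecke.SYT n lam) ZeroHecke.SYT.Below ∧
    ∃ B : Module.Basis (ZeroHecke.SYT n lam) ℂ (ZeroHecke.Specht n lam),
      (∀ T, B T = T.1.polytabloidSpecht) ∧
      ∃ ρ : ZeroHecke.HeckeZero n →ₐ[ℂ] Module.End ℂ (ZeroHecke.Specht n lam),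
        ZeroHecke.IsDeformation (ZeroHecke.spechtRep n lam) B ZeroHecke.SYT.Below ρ ∧
        (∀ ρ' : ZeroHecke.HeckeZero n →ₐ[ℂ] Module.End ℂ (ZeroHecke.Specht n lam),
          ZeroHecke.IsDeformation (ZeroHecke.spechtRep n lam) B ZeroHecke.SYT.Below ρ' →
            ρ' = ρ) ∧
        ∀ N : ℕ,
          ZeroHecke.frobQChar N n (ZeroHecke.HeckeModule ρ)
            = ∑ T : ZeroHecke.SYT n lam, ZeroHecke.fundamental N n T.ides ∧
          ∑ T : ZeroHecke.SYT n lam, ZeroHecke.fundamental N n T.ides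
            = ZeroHecke.schur N lam ∧
          ZeroHecke.schur N lam = ZeroHecke.frobChar N (ZeroHecke.spechtRep n lam) := by
  open ZeroHecke in
  refine ⟨?_, spechtBasis hlam, spechtBasis_apply hlam, spechtHecke hlam,
    isDeformation_spechtHecke hlam, fun ρ' h => (isDeformation_spechtHecke hlam).unique h,
    fun N => ⟨frobQChar_spechtHecke hlam N, sum_fundamental_eq_schur hlam N, ?_⟩⟩
  · rw [SYT.below_eq]
    infer_instance
  · rw [← sum_fundamental_eq_schur hlam, sum_fundamental_eq_frobChar hlam]
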